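/- Let $\mathcal V$ be a real Banach space with complexification $\mathcal V_{\mathbb C}=\mathcal V+i\mathcal V$, and let $\mathcal B(\mathcal V)$ be the algebra of bounded real-linear operators on $\mathcal V$. Write $T_{\mathbb C}(x+iy)=Tx+iTy$ for the extension of $T\in\mathcal B(\mathcal V)$ to $\mathcal V_{\mathbb C}$; through $T\mapsto T_{\mathbb C}$, regard $\mathcal B(\mathcal V)$ as a real subalgebra of $\mathcal B(\mathcal V)_{\mathbb C}=\mathcal B(\mathcal V_{\mathbb C})$. The conjugation of $\mathcal B(\mathcal V)_{\mathbb C}$ is $\overline{S}=CSC$ with $C(x+iy)=x-iy$. The complex spectrum of $T\in\mathcal B(\mathcal V)$ is $$\sigma_{\mathbb C}(T)=\{u+iv:\ u,v\in\mathbb R,\ (u-T)^2+v^2 \text{ is not invertible in } \mathcal B(\mathcal V)\}.$$ Let $U\subset\mathbb C$ be open and conjugate symmetric ($\zeta\in U\iff\bar\zeta\in U$). Let $\mathcal O_s(U,\mathcal B(\mathcal V)_{\mathbb C})$ be the real algebra of analytic functions $F:U\to\mathcal B(\mathcal V)_{\mathbb C}$ with $F(\bar\zeta)=\overline{F(\zeta)}$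 for all $\zeta\in U$ (stem functions), and let $\mathcal O_s(U)$ be the real algebra of analytic functions $f:U\to\mathbb C$ with $f(\bar\zeta)=\overline{f(\zeta)}$ for all $\zeta\in U$. A Cauchy domain in $U$ is a bounded open set $\Delta$ with $\overline\Delta\subset U$ whose boundary $\Gamma$ consists of a finite family of piecewise smooth closed curves, positively oriented, that is, with total winding number $1$ around each point of $\Delta$ and $0$ around each point outside $\overline\Delta$. Let $T\in\mathcal B(\mathcal V)$ with $\sigma_{\mathbb C}(T)\subset U$. Then there is a Cauchy domain $\Delta$ in $U$ with $\sigma_{\mathbb C}(T)\subset\Delta$. For every $F\in\mathcal O_s(U,\mathcal B(\mathcal V)_{\mathbb C})$ the integral $$F(T)=\frac1{2\pi i}\int_\Gamma F(\zeta)(\zeta-T)^{-1}\,d\zeta,$$ where $\Gamma$ is the boundary of a Cauchy domain in $U$ containing $\sigma_{\mathbb C}(T)$, does not depend on the choice of the Cauchy domain and belongs to $\mathcal B(\mathcal V)$. The map $$\mathcal O_s(U,\mathcal B(\mathcal V)_{\mathbb C})\ni F\mapsto F(T)\in\mathcal B(\mathcal V)$$ is $\mathbb R$-linear, and the map $$\mathcal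 O_s(U)\ni f\mapsto f(T)\in\mathcal B(\mathcal V),$$ where $f$ is identified with the function $\zeta\mapsto f(\zeta)\cdot 1$, is a unital real algebra morphism. Moreover: (1) For all $F\in\mathcal O_s(U,\mathcal B(\mathcal V)_{\mathbb C})$ and $f\in\mathcal O_s(U)$ we have $(Ff)(T)=F(T)f(T)$. (2) For every polynomial $P(\zeta)=\sum_{n=0}^m A_n\zeta^n$ with $A_0,\dots,A_m\in\mathcal B(\mathcal V)$ we have $P(T)=\sum_{n=0}^m A_nT^n$. -/

import Mathlib

open scoped ComplexConjugate

noncomputable section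

/-! ### The complexification of a real Banach space -/

/-- The complexification `V + iV` of a real vector space `V`; `⟨x, y⟩` stands for `x + iy`. -/
@[ext]
structure Complexified (V : Type*) where
  re : V
  im : V

namespace Complexified

variable {V : Type*} [NormedAddCommGroup V]

instance : Zero (Complexified V) := ⟨⟨0, 0⟩⟩
instance : Add (Complexified V) := ⟨fun w w' => ⟨w.re + w'.re, w.im + w'.im⟩⟩
instance : Neg (Complexified V) := ⟨fun w => ⟨-w.re, -w.im⟩⟩
instance : Sub (Complexified V) := ⟨fun w w' => ⟨w.re - w'.re, w.im - w'.im⟩⟩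

@[simp] theorem zero_re : (0 : Complexified V).re = 0 := rfl
@[simp] theorem zero_im : (0 : Complexified V).im = 0 := rfl
@[simp] theorem add_re (w w' : Complexified V) : (w + w').re = w.re + w'.re := rfl
@[simp] theorem add_im (w w' : Complexified V) : (w + w').im = w.im + w'.im := rfl
@[simp] theorem neg_re (w : Complexified V) : (-w).re = -w.re := rfl
@[simp] theorem neg_im (w : Complexified V) : (-w).im = -w.im := rfl
@[simp] theorem sub_re (w w' : Complexified V) : (w - w').re = w.re - w'.re := rfl
@[simp] theorem sub_im (w w' : Complexified V) : (w - w').im = w.im - w'.im := rfl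
variable [NormedSpace ℝ V]

/-- `(a + ib)(x + iy) = (ax - by) + i(ay + bx)`. -/
instance : SMul ℂ (Complexified V) :=
  ⟨fun c w => ⟨c.re • w.re - c.im • w.im, c.re • w.im + c.im • w.re⟩⟩

@[simp] theorem smul_re (c : ℂ) (w : Complexified V) :
    (c • w).re = c.re • w.re - c.im • w.im := rfl
@[simp] theorem smul_im (c : ℂ) (w : Complexified V) :
    (c • w).im = c.re • w.im + c.im • w.re := rfl

instance : AddCommGroup (Complexified V) where
  add_assoc _ _ _ := by ext <;> simp [add_assoc]
  zero_add _ := by ext <;> simp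
  add_zero _ := by ext <;> simp
  add_comm _ _ := by ext <;> simp [add_comm]
  neg_add_cancel _ := by ext <;> simp
  sub_eq_add_neg _ _ := by ext <;> simp [sub_eq_add_neg]
  nsmul := nsmulRec
  zsmul := zsmulRec

instance : Module ℂ (Complexified V) where
  one_smul _ := by ext <;> simp
  mul_smul a b w := by
    ext
    · simp only [smul_re, smul_im, Complex.mul_re, Complex.mul_im]; module
    · simp only [smul_re, smul_im, Complex.mul_re, Complex.mul_im]; module
  smul_zero _ := by ext <;> simp
  smul_add a w w' := by
    ext
    · simp only [smul_re, add_re, add_im]; module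
    · simp only [smul_im, add_re, add_im]; module
  add_smul a b w := by
    ext
    · simp only [smul_re, add_re, Complex.add_re, Complex.add_im]; module
    · simp only [smul_im, add_im, Complex.add_re, Complex.add_im]; module
  zero_smul _ := by ext <;> simp

/-- The map `z ↦ Re (z w)`, a bounded real-linear map from `ℂ` to `V`. -/
def rotate : Complexified V →+ (ℂ →L[ℝ] V) where
  toFun w := Complex.reCLM.smulRight w.re - Complex.imCLM.smulRight w.im
  map_zero' := by ext; simp
  map_add' w w' := by
    ext z
    simp only [add_re, add_im, sub_apply, add_apply,
      ContinuousLinearMap.smulRight_apply, smul_add]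
    abel

theorem rotate_apply (w : Complexified V) (z : ℂ) : rotate w z = (z • w).re := by
  simp [rotate]

theorem rotate_injective : Function.Injective (rotate (V := V)) := by
  intro w w' h
  have h1 := DFunLike.congr_fun h 1
  have h2 := DFunLike.congr_fun h Complex.I
  simp only [rotate_apply, smul_re, Complex.I_re, Complex.I_im, one_smul, zero_smul, zero_sub,
    neg_inj] at h1 h2
  ext
  · exact h1
  · exact h2

/-- The norm `‖w‖ = sup {‖Re (z w)‖ : |z| ≤ 1}`. It induces the norm of `V` on `V`, and it is
equivalent to `‖x‖ + ‖y‖` for `w = x + iy`. -/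
instance : NormedAddCommGroup (Complexified V) :=
  NormedAddCommGroup.induced (Complexified V) (ℂ →L[ℝ] V) rotate rotate_injective

theorem norm_def (w : Complexified V) : ‖w‖ = ‖rotate w‖ := rfl

theorem norm_smul_re_le (z : ℂ) (w : Complexified V) : ‖(z • w).re‖ ≤ ‖w‖ * ‖z‖ := by
  rw [← rotate_apply, norm_def]
  exact (rotate w).le_opNorm z

instance : NormedSpace ℂ (Complexified V) where
  norm_smul_le c w := by
    rw [norm_def (c • w)]
    refine ContinuousLinearMap.opNorm_le_bound _ (by positivity) fun z => ?_
    rw [rotate_apply, smul_smul]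
    refine (norm_smul_re_le _ _).trans (le_of_eq ?_)
    rw [norm_mul]
    ring

theorem norm_re_le (w : Complexified V) : ‖w.re‖ ≤ ‖w‖ := by
  simpa using norm_smul_re_le 1 w

theorem norm_im_le (w : Complexified V) : ‖w.im‖ ≤ ‖w‖ := by
  simpa using norm_smul_re_le Complex.I w

theorem norm_le (w : Complexified V) : ‖w‖ ≤ ‖w.re‖ + ‖w.im‖ := by
  rw [norm_def]
  refine ContinuousLinearMap.opNorm_le_bound _ (by positivity) fun z => ?_
  rw [rotate_apply, smul_re]
  refine (norm_sub_le _ _).trans ?_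
  rw [norm_smul, norm_smul, add_mul, mul_comm ‖z.re‖, mul_comm ‖z.im‖]
  gcongr
  · exact Complex.abs_re_le_norm z
  · exact Complex.abs_im_le_norm z

instance [CompleteSpace V] : CompleteSpace (Complexified V) := by
  refine Metric.complete_of_cauchySeq_tendsto fun u hu => ?_
  have hre : CauchySeq fun n => (u n).re := by
    rw [Metric.cauchySeq_iff'] at hu ⊢
    intro ε hε
    obtain ⟨N, hN⟩ := hu ε hε
    refine ⟨N, fun n hn => lt_of_le_of_lt ?_ (hN n hn)⟩
    rw [dist_eq_norm, dist_eq_norm, ← sub_re]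
    exact norm_re_le _
  have him : CauchySeq fun n => (u n).im := by
    rw [Metric.cauchySeq_iff'] at hu ⊢
    intro ε hε
    obtain ⟨N, hN⟩ := hu ε hε
    refine ⟨N, fun n hn => lt_of_le_of_lt ?_ (hN n hn)⟩
    rw [dist_eq_norm, dist_eq_norm, ← sub_im]
    exact norm_im_le _
  obtain ⟨x, hx⟩ := cauchySeq_tendsto_of_complete hre
  obtain ⟨y, hy⟩ := cauchySeq_tendsto_of_complete him
  refine ⟨⟨x, y⟩, ?_⟩
  rw [tendsto_iff_norm_sub_tendsto_zero] at hx hy ⊢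
  refine squeeze_zero (fun _ => norm_nonneg _) (fun n => norm_le _) ?_
  simpa using hx.add hy

/-- The conjugation `C (x + iy) = x - iy`. -/
def conjL : Complexified V →L[ℝ] Complexified V :=
  LinearMap.mkContinuous
    { toFun := fun w => ⟨w.re, -w.im⟩
      map_add' := fun w w' => by
        ext
        · simp
        · simp [add_comm]
      map_smul' := fun c w => by
        ext
        · simp [← Complex.coe_smul]
        · simp [← Complex.coe_smul] }
    2 fun w => by
      refine (norm_le _).trans ?_
      simp only [LinearMap.coe_mk, AddHom.coe_mk, norm_neg]
      linarith [norm_re_le w, norm_im_le w]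

@[simp] theorem conjL_re (w : Complexified V) : (conjL w).re = w.re := rfl
@[simp] theorem conjL_im (w : Complexified V) : (conjL w).im = -w.im := rfl

theorem conjL_conjL (w : Complexified V) : conjL (conjL w) = w := by
  ext <;> simp

theorem conjL_smul (c : ℂ) (w : Complexified V) : conjL (c • w) = conj c • conjL w := by
  ext
  · simp
  · simp [add_comm]

/-- The conjugation `S ↦ S♭ = C S C` of the algebra `B(V_ℂ)`. -/
def flat : (Complexified V →L[ℂ] Complexified V) →ₐ[ℝ] (Complexified V →L[ℂ] Complexified V) where
  toFun S :=
    { toFun := fun w => conjL (S (conjL w))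
      map_add' := fun w w' => by simp
      map_smul' := fun c w => by simp [conjL_smul]
      cont := by fun_prop }
  map_one' := by ext1 w; exact conjL_conjL w
  map_mul' S S' := by
    ext1 w
    change conjL (S (S' (conjL w))) = conjL (S (conjL (conjL (S' (conjL w)))))
    rw [conjL_conjL]
  map_zero' := by ext1 w; exact conjL.map_zero
  map_add' S S' := by ext1 w; exact conjL.map_add _ _
  commutes' r := by
    ext1 w
    change conjL ((r : ℂ) • conjL w) = (r : ℂ) • w
    rw [conjL_smul, conjL_conjL, Complex.conj_ofReal]

theorem flat_apply (S : Complexified V →L[ℂ] Complexified V) (w : Complexified V) :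
    flat S w = conjL (S (conjL w)) := rfl

/-- The extension `T_ℂ (x + iy) = T x + i T y` of `T ∈ B(V)` to `V_ℂ`. This is the embedding of
`B(V)` into `B(V_ℂ)` as a real subalgebra. -/
def extend (T : V →L[ℝ] V) : Complexified V →L[ℂ] Complexified V :=
  LinearMap.mkContinuous
    { toFun := fun w => ⟨T w.re, T w.im⟩
      map_add' := fun w w' => by ext <;> simp
      map_smul' := fun c w => by ext <;> simp }
    (2 * ‖T‖) fun w => by
      refine (norm_le _).trans ?_
      have h1 := (T.le_opNorm w.re).trans
        (mul_le_mul_of_nonneg_left (norm_re_le w) (norm_nonneg T))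
      have h2 := (T.le_opNorm w.im).trans
        (mul_le_mul_of_nonneg_left (norm_im_le w) (norm_nonneg T))
      simp only [LinearMap.coe_mk, AddHom.coe_mk]
      linarith

@[simp] theorem extend_re (T : V →L[ℝ] V) (w : Complexified V) : (extend T w).re = T w.re := rfl
@[simp] theorem extend_im (T : V →L[ℝ] V) (w : Complexified V) : (extend T w).im = T w.im := rfl

theorem flat_extend (T : V →L[ℝ] V) : flat (extend T) = extend T := by
  ext1 w
  rw [flat_apply]
  ext <;> simp

theorem flat_smul (c : ℂ) (S : Complexified V →L[ℂ] Complexified V) :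
    flat (c • S) = conj c • flat S := by
  ext1 w
  simp [flat_apply, conjL_smul]

end Complexified

/-- The complex spectrum of a real operator:
all `u + iv` such that `(u - T)² + v²` is not invertible in `B(V)`. -/
def complexSpectrum {V : Type*} [NormedAddCommGroup V] [NormedSpace ℝ V] (T : V →L[ℝ] V) :
    Set ℂ :=
  {z | ¬ IsUnit ((z.re • (1 : V →L[ℝ] V) - T) ^ 2 + (z.im ^ 2) • (1 : V →L[ℝ] V))}

/-! ### Stem functions -/

/-- `U` is conjugate symmetric. -/
def ConjSymmetric (U : Set ℂ) : Prop := ∀ z : ℂ, z ∈ U ↔ conj z ∈ U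

/-- The extension by zero of a function on `U` to all of `ℂ`. -/
def extendZero {U : Set ℂ} {A : Type*} [Zero A] (F : U → A) : ℂ → A :=
  Function.extend Subtype.val F 0

theorem extendZero_of_mem {U : Set ℂ} {A : Type*} [Zero A] (F : U → A) {z : ℂ} (hz : z ∈ U) :
    extendZero F z = F ⟨z, hz⟩ :=
  Subtype.val_injective.extend_apply F 0 ⟨z, hz⟩

/-- A function on `U` is analytic if it is complex differentiable on the (open) set `U`. -/
def AnalyticOnDomain {U : Set ℂ} {A : Type*} [NormedAddCommGroup A] [NormedSpace ℂ A]
    (F : U → A) : Prop :=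
  DifferentiableOn ℂ (extendZero F) U

theorem analyticOnDomain_of_eq {U : Set ℂ} {A : Type*} [NormedAddCommGroup A] [NormedSpace ℂ A]
    {F : U → A} {G : ℂ → A} (hG : DifferentiableOn ℂ G U) (h : ∀ z : U, F z = G z) :
    AnalyticOnDomain F :=
  hG.congr fun z hz => by rw [extendZero_of_mem F hz, h]

/-- The real algebra of stem functions on `U` with values in a complex Banach algebra `A` with a
conjugation `c`: the analytic functions `F : U → A` with `F(conj ζ) = c (F ζ)` for `ζ ∈ U`. -/
def stemFunctions (U : Set ℂ) {A : Type*} [NormedRing A] [NormedAlgebra ℂ A] (c : A →ₐ[ℝ] A) :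
    Subalgebra ℝ (U → A) where
  carrier := {F | AnalyticOnDomain F ∧ ∀ ζ ξ : U, (ξ : ℂ) = conj (ζ : ℂ) → F ξ = c (F ζ)}
  mul_mem' {F G} hF hG :=
    ⟨analyticOnDomain_of_eq (hF.1.mul hG.1) fun z => by
      simp [extendZero_of_mem _ z.2], fun ζ ξ h => by simp [hF.2 ζ ξ h, hG.2 ζ ξ h]⟩
  add_mem' {F G} hF hG :=
    ⟨analyticOnDomain_of_eq (hF.1.add hG.1) fun z => by
      simp [extendZero_of_mem _ z.2], fun ζ ξ h => by simp [hF.2 ζ ξ h, hG.2 ζ ξ h]⟩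
  algebraMap_mem' r :=
    ⟨analyticOnDomain_of_eq (differentiableOn_const (algebraMap ℝ A r)) fun z => rfl,
      fun ζ ξ h => by simp⟩

/-- The algebra `O_s(U)` of complex-valued stem functions. -/
abbrev ScalarStem (U : Set ℂ) : Type :=
  stemFunctions U (Complex.conjAe : ℂ →ₐ[ℝ] ℂ)

/-- The algebra `O_s(U, B(V)_ℂ)` of operator-valued stem functions, where `B(V)_ℂ` is identified
with `B(V_ℂ)` and its conjugation with `S ↦ S♭`. -/
abbrev OperatorStem (U : Set ℂ) (V : Type*) [NormedAddCommGroup V] [NormedSpace ℝ V] : Type _ :=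
  stemFunctions U (Complexified.flat (V := V))

section

variable {U : Set ℂ} {V : Type*} [NormedAddCommGroup V] [NormedSpace ℝ V]

/-- A scalar stem function as an operator-valued one: `ζ ↦ f(ζ) · 1`. -/
def ScalarStem.toOperator (f : ScalarStem U) : OperatorStem U V :=
  ⟨fun ζ => f.1 ζ • 1,
    analyticOnDomain_of_eq
      (f.2.1.smul_const (1 : Complexified V →L[ℂ] Complexified V)) fun z => by
        rw [extendZero_of_mem _ z.2],
    fun ζ ξ h => by
      change f.1 ξ • (1 : Complexified V →L[ℂ] Complexified V) = _
      rw [Complexified.flat_smul, map_one, f.2.2 ζ ξ h]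
      rfl⟩

/-- The product `F f : ζ ↦ f(ζ) F(ζ)` of an operator-valued stem function and a scalar one. -/
def OperatorStem.mulScalar (F : OperatorStem U V) (f : ScalarStem U) : OperatorStem U V :=
  ⟨fun ζ => f.1 ζ • F.1 ζ,
    analyticOnDomain_of_eq (f.2.1.smul F.2.1) fun z => by
      simp [extendZero_of_mem _ z.2],
    fun ζ ξ h => by
      change f.1 ξ • F.1 ξ = _
      rw [Complexified.flat_smul, f.2.2 ζ ξ h, F.2.2 ζ ξ h]
      rfl⟩

/-- The polynomial `P(ζ) = ∑_{n ≤ m} A_n ζⁿ` with coefficients in `B(V)`, as a stem function. -/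
def polynomialStem (U : Set ℂ) (m : ℕ) (A : ℕ → V →L[ℝ] V) : OperatorStem U V :=
  ⟨fun ζ => ∑ n ∈ Finset.range (m + 1), (ζ : ℂ) ^ n • Complexified.extend (A n),
    analyticOnDomain_of_eq
      (G := fun ζ => ∑ n ∈ Finset.range (m + 1), ζ ^ n • Complexified.extend (A n))
      (by fun_prop) fun z => rfl,
    fun ζ ξ h => by
      simp only [map_sum, Complexified.flat_smul, Complexified.flat_extend, map_pow, h]⟩

end

/-! ### Cauchy domains and the Riesz-Dunford integral -/

/-- A piecewise smooth closed curve in the plane, parametrized by `[0, 1]`. -/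
structure ClosedCurve where
  base : ℂ
  path : Path base base
  piecewise_smooth : ∃ (n : ℕ) (t : ℕ → ℝ), Monotone t ∧ t 0 = 0 ∧ t n = 1 ∧
    ∀ i < n, ContDiffOn ℝ 1 path.extend (Set.Icc (t i) (t (i + 1)))

/-- The integral `∫_Γ f(ζ) dζ` along a finite family `Γ` of closed curves. -/
def contourIntegral {E : Type*} [NormedAddCommGroup E] [NormedSpace ℂ E] {k : ℕ}
    (Γ : Fin k → ClosedCurve) (f : ℂ → E) : E :=
  ∑ j, curveIntegral (fun ζ => ContinuousLinearMap.toSpanSingleton ℂ (f ζ)) (Γ j).path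

/-- A Cauchy domain in `U`: a bounded open set `Δ` with `closure Δ ⊆ U` whose boundary consists of
a finite family of piecewise smooth closed curves. The family is positively oriented: it winds once
around every point of `Δ` and does not wind around the points outside `closure Δ`. -/
structure CauchyDomain (U : Set ℂ) where
  carrier : Set ℂ
  isOpen : IsOpen carrier
  isBounded : Bornology.IsBounded carrier
  closure_subset : closure carrier ⊆ U
  card : ℕ
  boundary : Fin card → ClosedCurve
  frontier_eq : frontier carrier = ⋃ j, Set.range (boundary j).path
  winding_inside : ∀ z ∈ carrier,
    (2 * Real.pi * Complex.I)⁻¹ * contourIntegral boundary (fun ζ => (ζ - z)⁻¹) = 1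
  winding_outside : ∀ z ∉ closure carrier,
    (2 * Real.pi * Complex.I)⁻¹ * contourIntegral boundary (fun ζ => (ζ - z)⁻¹) = 0

/-- The Riesz-Dunford integral `(2πi)⁻¹ ∫_Γ F(ζ) (ζ - T)⁻¹ dζ` over the boundary `Γ` of a Cauchy
domain, with values in `B(V_ℂ)`. Here `resolvent T_ℂ ζ` is the inverse of `ζ - T_ℂ`. -/
def rieszDunford {U : Set ℂ} {V : Type*} [NormedAddCommGroup V] [NormedSpace ℝ V]
    (Δ : CauchyDomain U) (T : V →L[ℝ] V) (F : OperatorStem U V) :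
    Complexified V →L[ℂ] Complexified V :=
  (2 * Real.pi * Complex.I : ℂ)⁻¹ • contourIntegral Δ.boundary
    (fun ζ => extendZero F.1 ζ * resolvent (Complexified.extend T) ζ)

end

/-! Two facts carry the analysis: winding numbers determine the contour integrals of analytic
functions, and a compact subset of an open set can be surrounded, inside it, by finitely many grid
squares.

Let closed curves run in a compact subset L of an open set W. Take a union of small squares in W
with L in its interior, write an analytic f on the curves by Cauchy's formula over the boundary of
this union, and exchange the integrals (`PiecewiseSmooth.integral_eq_gridIntegral`). Only the
winding of the curves around points off L remains. The resulting homology form of Cauchy's theorem,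
`contourIntegral_eq_of_winding`, yields Cauchy's formula on Cauchy domains, independence of the
domain and the behaviour under conjugation. The formula for unions of squares comes from rectangles,
since inner edges cancel. Such unions also provide Cauchy domains: their boundary edges are balanced
at every vertex, so they join to closed curves (`splitsIntoCurves`).

In a complex Banach algebra, the resolvent identity shows that (z - t)⁻¹ (f(z) - f(t)) extends
analytically across the spectrum (`exists_differentiableOn_resolvent_mul`). For f = 1, Liouville's
theorem then gives 1(t) = 1. Multiplying the extension by F and applying Cauchy's theorem gives
(Ff)(t) = F(t) f(t), and polynomials follow.

For real T, the factorization (z - T)(conj z - T) = (u - T)² + v² identifies the complex spectrum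
with the spectrum of the extension of T, which is thus conjugate symmetric. Conjugation turns the
integral into one over the mirrored curves, which wind -1 times around the spectrum. This sign
cancels the one from conjugating (2πi)⁻¹, so F(T) is fixed by the conjugation and is a real
operator. -/

open scoped ComplexConjugate

noncomputable section

/-! ### Integrals along piecewise smooth paths -/

section PathIntegral

open MeasureTheory Set

variable {E : Type*} [NormedAddCommGroup E] [NormedSpace ℂ E] {a b c d : ℂ}

/-- The integral `∫_p f(ζ) dζ` along a path. -/
def pathIntegral (p : Path a b) (f : ℂ → E) : E :=
  curveIntegral (fun ζ => ContinuousLinearMap.toSpanSingleton ℂ (f ζ)) p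

/-- A path which is continuously differentiable on the pieces of a partition of `[0, 1]`. -/
def PiecewiseSmooth (p : Path a b) : Prop :=
  ∃ (n : ℕ) (t : ℕ → ℝ), Monotone t ∧ t 0 = 0 ∧ t n = 1 ∧
    ∀ i < n, ContDiffOn ℝ 1 p.extend (Set.Icc (t i) (t (i + 1)))

theorem contourIntegral_eq_sum {k : ℕ} (Γ : Fin k → ClosedCurve) (f : ℂ → E) :
    contourIntegral Γ f = ∑ j, pathIntegral (Γ j).path f := rfl

theorem pathIntegral_eq (p : Path a b) (f : ℂ → E) :
    pathIntegral p f =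
      ∫ t in (0 : ℝ)..1, derivWithin p.extend (Icc 0 1) t • f (p.extend t) := by
  rw [pathIntegral, curveIntegral_def]
  simp [curveIntegralFun_def]

theorem Path.extend_mem_range (p : Path a b) (t : ℝ) : p.extend t ∈ range p := by
  rw [← p.extend_range]
  exact mem_range_self t

theorem Path.isCompact_range (p : Path a b) : IsCompact (range p) :=
  _root_.isCompact_range p.continuous

theorem Path.continuous_comp_extend {X : Type*} [TopologicalSpace X] (p : Path a b) {f : ℂ → X}
    (hf : ContinuousOn f (range p)) : Continuous fun t => f (p.extend t) :=
  hf.comp_continuous p.continuous_extend p.extend_mem_range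

/-- The derivative is continuous, hence integrable, on each closed piece; one-sided derivatives may
disagree only at the breakpoints, a null set. -/
theorem PiecewiseSmooth.intervalIntegrable_deriv {p : Path a b} (hp : PiecewiseSmooth p) :
    IntervalIntegrable (derivWithin p.extend (Icc 0 1)) volume 0 1 := by
  obtain ⟨n, t, ht, h0, h1, hsm⟩ := hp
  rw [← h0, ← h1]
  refine IntervalIntegrable.trans_iterate fun i hi => ?_
  have hle : t i ≤ t (i + 1) := ht (Nat.le_succ i)
  -- The partition is only monotone, so a piece may reduce to a point.
  rcases hle.eq_or_lt with heq | hlt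
  · rw [heq]
  have hcont : ContinuousOn (derivWithin p.extend (Icc (t i) (t (i + 1))))
      (Icc (t i) (t (i + 1))) :=
    (hsm i hi).continuousOn_derivWithin (uniqueDiffOn_Icc hlt) le_rfl
  have hcontour := hcont.intervalIntegrable_of_Icc (μ := volume) hle
  -- On the open piece, derivatives within the piece and within [0, 1] are both the ordinary
  -- derivative.
  rw [intervalIntegrable_iff_integrableOn_Ioo_of_le hle] at hcontour ⊢
  refine hcontour.congr_fun (fun s hs => ?_) measurableSet_Ioo
  have hs' : s ∈ Ioo (0 : ℝ) 1 := by
    refine ⟨lt_of_le_of_lt ?_ hs.1, lt_of_lt_of_le hs.2 ?_⟩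
    · rw [← h0]; exact ht (Nat.zero_le i)
    · rw [← h1]; exact ht hi
  rw [derivWithin_of_mem_nhds (Icc_mem_nhds hs.1 hs.2), h0, h1,
    derivWithin_of_mem_nhds (Icc_mem_nhds hs'.1 hs'.2)]

theorem PiecewiseSmooth.intervalIntegrable {p : Path a b} (hp : PiecewiseSmooth p) {f : ℂ → E}
    (hf : ContinuousOn f (range p)) :
    IntervalIntegrable (fun t => derivWithin p.extend (Icc 0 1) t • f (p.extend t))
      volume 0 1 :=
  hp.intervalIntegrable_deriv.smul_continuousOn (p.continuous_comp_extend hf).continuousOn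

theorem PiecewiseSmooth.curveIntegrable {p : Path a b} (hp : PiecewiseSmooth p) {f : ℂ → E}
    (hf : ContinuousOn f (range p)) :
    CurveIntegrable (fun ζ => ContinuousLinearMap.toSpanSingleton ℂ (f ζ)) p := by
  have h := hp.intervalIntegrable hf
  rw [CurveIntegrable]
  convert h using 2
  simp [curveIntegralFun_def]

theorem pathIntegral_congr (p : Path a b) {f g : ℂ → E} (h : EqOn f g (range p)) :
    pathIntegral p f = pathIntegral p g := by
  rw [pathIntegral_eq, pathIntegral_eq]
  congr with t
  rw [h (p.extend_mem_range t)]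

theorem PiecewiseSmooth.integral_add {p : Path a b} (hp : PiecewiseSmooth p) {f g : ℂ → E}
    (hf : ContinuousOn f (range p)) (hg : ContinuousOn g (range p)) :
    pathIntegral p (fun ζ => f ζ + g ζ) = pathIntegral p f + pathIntegral p g := by
  simp only [pathIntegral_eq, smul_add]
  exact intervalIntegral.integral_add (hp.intervalIntegrable hf) (hp.intervalIntegrable hg)

theorem PiecewiseSmooth.integral_sub {p : Path a b} (hp : PiecewiseSmooth p) {f g : ℂ → E}
    (hf : ContinuousOn f (range p)) (hg : ContinuousOn g (range p)) :
    pathIntegral p (fun ζ => f ζ - g ζ) = pathIntegral p f - pathIntegral p g := by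
  simp only [pathIntegral_eq, smul_sub]
  exact intervalIntegral.integral_sub (hp.intervalIntegrable hf) (hp.intervalIntegrable hg)

theorem PiecewiseSmooth.integral_sum {p : Path a b} (hp : PiecewiseSmooth p) {ι : Type*}
    (s : Finset ι) {f : ι → ℂ → E} (hf : ∀ i ∈ s, ContinuousOn (f i) (range p)) :
    pathIntegral p (fun ζ => ∑ i ∈ s, f i ζ) = ∑ i ∈ s, pathIntegral p (f i) := by
  simp only [pathIntegral_eq, Finset.smul_sum]
  exact intervalIntegral.integral_finsetSum fun i hi => hp.intervalIntegrable (hf i hi)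

theorem pathIntegral_smul (p : Path a b) (k : ℂ) (f : ℂ → E) :
    pathIntegral p (fun ζ => k • f ζ) = k • pathIntegral p f := by
  simp only [pathIntegral_eq, smul_comm _ k]
  exact intervalIntegral.integral_smul k _

theorem pathIntegral_symm (p : Path a b) (f : ℂ → E) :
    pathIntegral p.symm f = -pathIntegral p f :=
  curveIntegral_symm _ _

/-- A bounded linear operator commutes with the integral. -/
theorem PiecewiseSmooth.map_integral [CompleteSpace E] {F : Type*} [NormedAddCommGroup F]
    [NormedSpace ℂ F] [CompleteSpace F] (L : E →L[ℂ] F) {p : Path a b} (hp : PiecewiseSmooth p)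
    {f : ℂ → E} (hf : ContinuousOn f (range p)) :
    L (pathIntegral p f) = pathIntegral p fun ζ => L (f ζ) := by
  simp only [pathIntegral_eq, ← map_smul]
  exact (L.intervalIntegral_comp_comm (hp.intervalIntegrable hf)).symm

theorem pathIntegral_smul_const [CompleteSpace E] (p : Path a b) (f : ℂ → ℂ) (x : E) :
    pathIntegral p (fun ζ => f ζ • x) = pathIntegral p f • x := by
  simp only [pathIntegral_eq, ← smul_assoc]
  exact intervalIntegral.integral_smul_const _ x

theorem continuousOn_inv_sub {s : Set ℂ} {z : ℂ} (hz : z ∉ s) :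
    ContinuousOn (fun w => (w - z)⁻¹) s :=
  (continuousOn_id.sub continuousOn_const).inv₀ fun w hw h => by
    have hwz : w = z := sub_eq_zero.1 h
    exact hz (hwz ▸ hw)

/-- Fubini's theorem for integrals along two paths. -/
theorem PiecewiseSmooth.integral_swap [CompleteSpace E] {p : Path a b} {q : Path c d}
    (hp : PiecewiseSmooth p) (hq : PiecewiseSmooth q) {K : ℂ → ℂ → E}
    (hK : ContinuousOn (Function.uncurry K) (range p ×ˢ range q)) :
    pathIntegral p (fun ζ => pathIntegral q fun w => K ζ w) =
      pathIntegral q fun w => pathIntegral p fun ζ => K ζ w := by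
  simp only [pathIntegral_eq]
  simp only [← intervalIntegral.integral_smul]
  simp only [intervalIntegral.integral_of_le zero_le_one]
  have hKc : Continuous fun z : ℝ × ℝ => K (p.extend z.1) (q.extend z.2) :=
    hK.comp_continuous
      ((p.continuous_extend.comp continuous_fst).prodMk (q.continuous_extend.comp continuous_snd))
      fun z => ⟨p.extend_mem_range _, q.extend_mem_range _⟩
  obtain ⟨C, hC⟩ := (p.isCompact_range.prod q.isCompact_range).exists_bound_of_continuousOn hK
  have hdp := hp.intervalIntegrable_deriv.1
  have hdq := hq.intervalIntegrable_deriv.1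
  rw [integral_integral_swap]
  · congr with t
    congr with s
    exact smul_comm _ _ _
  -- The product of the two integrable derivatives is integrable on the square, and the kernel is
  -- bounded by compactness.
  · have h := (hdp.mul_prod hdq).smul_of_top_left
      (f := fun z : ℝ × ℝ => K (p.extend z.1) (q.extend z.2))
      (memLp_top_of_bound hKc.aestronglyMeasurable C (Filter.Eventually.of_forall fun z =>
        hC (p.extend z.1, q.extend z.2) ⟨p.extend_mem_range _, q.extend_mem_range _⟩))
    refine h.congr (Filter.Eventually.of_forall fun z => ?_)
    simp [mul_smul, Function.uncurry]

/-- A Cauchy integral is a complex differentiable function off the path. -/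
theorem PiecewiseSmooth.differentiableOn_cauchy [CompleteSpace E] {p : Path a b}
    (hp : PiecewiseSmooth p) {φ : ℂ → E} (hφ : ContinuousOn φ (range p)) :
    DifferentiableOn ℂ (fun z => pathIntegral p fun ζ => (ζ - z)⁻¹ • φ ζ) (range p)ᶜ := by
  intro z₀ hz₀
  obtain ⟨r, hr, hball⟩ := Metric.isOpen_iff.1 p.isCompact_range.isClosed.isOpen_compl z₀ hz₀
  obtain ⟨C, hC⟩ := p.isCompact_range.exists_bound_of_continuousOn hφ
  have hC0 : 0 ≤ C := (norm_nonneg _).trans (hC a p.source_mem_range)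
  -- The path stays at distance at least r from z₀, hence r / 2 from the half ball; this uniform gap
  -- dominates the derivative of the kernel.
  have hne : ∀ z ∈ Metric.ball z₀ (r / 2), ∀ ζ ∈ range p, r / 2 ≤ ‖ζ - z‖ := by
    intro z hz ζ hζ
    have h1 : r ≤ dist ζ z₀ := by
      by_contra! h
      exact hball (Metric.mem_ball.2 h) hζ
    have h2 := dist_triangle ζ z z₀
    rw [Metric.mem_ball] at hz
    rw [← dist_eq_norm]
    linarith
  have hne0 : ∀ z ∈ Metric.ball z₀ (r / 2), ∀ ζ ∈ range p, ζ - z ≠ 0 := fun z hz ζ hζ =>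
    norm_pos_iff.1 (lt_of_lt_of_le (by positivity) (hne z hz ζ hζ))
  have hcont : ∀ z ∈ Metric.ball z₀ (r / 2),
      ContinuousOn (fun ζ => (ζ - z)⁻¹ • φ ζ) (range p) := fun z hz =>
    ((continuousOn_id.sub continuousOn_const).inv₀ (hne0 z hz)).smul hφ
  have hcont' : ∀ z ∈ Metric.ball z₀ (r / 2),
      ContinuousOn (fun ζ => ((ζ - z) ^ 2)⁻¹ • φ ζ) (range p) := fun z hz =>
    (((continuousOn_id.sub continuousOn_const).pow 2).inv₀
      fun ζ hζ => pow_ne_zero 2 (hne0 z hz ζ hζ)).smul hφ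
  have hz₀' : z₀ ∈ Metric.ball z₀ (r / 2) := Metric.mem_ball_self (by positivity)
  simp only [pathIntegral_eq]
  refine HasDerivAt.differentiableAt (f' := ∫ t in (0 : ℝ)..1, derivWithin p.extend (Icc 0 1) t •
    (((p.extend t - z₀) ^ 2)⁻¹ • φ (p.extend t))) ?_ |>.differentiableWithinAt
  refine (intervalIntegral.hasDerivAt_integral_of_dominated_loc_of_deriv_le
    (F' := fun z t => derivWithin p.extend (Icc 0 1) t •
      (((p.extend t - z) ^ 2)⁻¹ • φ (p.extend t)))
    (bound := fun t => ‖derivWithin p.extend (Icc 0 1) t‖ * (((r / 2) ^ 2)⁻¹ * C))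
    (Metric.ball_mem_nhds z₀ (half_pos hr)) ?_ (hp.intervalIntegrable (hcont z₀ hz₀'))
    ?_ ?_ ?_ ?_).2
  · filter_upwards [Metric.ball_mem_nhds z₀ (half_pos hr)] with z hz
    exact (intervalIntegrable_iff.1 (hp.intervalIntegrable (hcont z hz))).aestronglyMeasurable
  · exact (intervalIntegrable_iff.1
      (hp.intervalIntegrable (hcont' z₀ hz₀'))).aestronglyMeasurable
  · refine Filter.Eventually.of_forall fun t _ z hz => ?_
    rw [norm_smul, norm_smul, norm_inv, norm_pow]
    have h1 := hne z hz _ (p.extend_mem_range t)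
    have h2 := hC _ (p.extend_mem_range t)
    gcongr
  · exact hp.intervalIntegrable_deriv.norm.mul_const _
  · refine Filter.Eventually.of_forall fun t _ z hz => ?_
    have h := hne0 z hz _ (p.extend_mem_range t)
    have h1 : HasDerivAt (fun z => (p.extend t - z)⁻¹) (((p.extend t - z) ^ 2)⁻¹) z := by
      simpa using ((hasDerivAt_id z).const_sub (p.extend t)).fun_inv h
    exact (h1.smul_const _).const_smul _

theorem PiecewiseSmooth.refl (a : ℂ) : PiecewiseSmooth (Path.refl a) :=
  ⟨1, fun i => i, Nat.mono_cast, by simp, by simp, fun i _ => by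
    rw [Path.refl_extend]
    exact contDiffOn_const⟩

theorem piecewiseSmooth_segment (a b : ℂ) : PiecewiseSmooth (Path.segment a b) := by
  refine ⟨1, fun i => i, Nat.mono_cast, by simp, by simp, fun i hi => ?_⟩
  obtain rfl : i = 0 := by omega
  have h : ContDiffOn ℝ 1 (fun t : ℝ => a + t • (b - a)) (Icc 0 1) := by fun_prop
  simp only [Nat.cast_zero, zero_add, Nat.cast_one]
  refine h.congr fun t ht => ?_
  rw [Path.eqOn_extend_segment a b ht, AffineMap.lineMap_apply]
  simp [add_comm]

theorem PiecewiseSmooth.trans {p : Path a b} {q : Path b c} (hp : PiecewiseSmooth p)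
    (hq : PiecewiseSmooth q) : PiecewiseSmooth (p.trans q) := by
  obtain ⟨n, t, ht, ht0, ht1, hps⟩ := hp
  obtain ⟨m, s, hs, hs0, hs1, hqs⟩ := hq
  -- The breakpoints of `p` are squeezed into [0, 1/2] and those of `q` into [1/2, 1]; at index `n`
  -- both formulas give 1/2.
  refine ⟨n + m, fun i => if i ≤ n then t i / 2 else (1 + s (i - n)) / 2, ?_, by simp [ht0], ?_, ?_⟩
  · intro i j hij
    dsimp only
    split_ifs with h1 h2
    · have := ht hij
      linarith
    · have h3 : t i ≤ 1 := ht1 ▸ ht h1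
      have h4 : 0 ≤ s (j - n) := hs0 ▸ hs (Nat.zero_le _)
      linarith
    · omega
    · have := hs (Nat.sub_le_sub_right hij n)
      linarith
  · dsimp only
    split_ifs with h
    -- Impossible, since `s 0 = 0` and `s m = 1`.
    · obtain rfl : m = 0 := by omega
      linarith
    · simp [hs1]
  · intro i hi
    rcases lt_or_ge i n with h | h
    · have h1 : ContDiffOn ℝ 1 (fun u : ℝ => p.extend (2 * u)) (Icc (t i / 2) (t (i + 1) / 2)) :=
        (hps i h).comp (t := Icc (t i) (t (i + 1))) (by fun_prop) fun u hu => by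
          constructor <;> linarith [hu.1, hu.2]
      simp only [h.le, Nat.succ_le_of_lt h, if_true]
      refine h1.congr fun u hu => ?_
      have : t (i + 1) ≤ 1 := ht1 ▸ ht h
      exact Path.extend_trans_of_le_half _ _ (by linarith [hu.2])
    · obtain ⟨j, rfl⟩ := Nat.exists_eq_add_of_le h
      have hj : j < m := by omega
      have h1 : ContDiffOn ℝ 1 (fun u : ℝ => q.extend (2 * u - 1))
          (Icc ((1 + s j) / 2) ((1 + s (j + 1)) / 2)) :=
        (hqs j hj).comp (t := Icc (s j) (s (j + 1))) (by fun_prop) fun u hu => by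
          constructor <;> linarith [hu.1, hu.2]
      have h2 : (if n + j ≤ n then t (n + j) / 2 else (1 + s (n + j - n)) / 2) = (1 + s j) / 2 := by
        split_ifs with h3
        · obtain rfl : j = 0 := by omega
          simp [ht1, hs0]
        · simp
      have h3 : ¬ n + j + 1 ≤ n := by omega
      simp only [h2, h3, if_false]
      rw [show n + j + 1 - n = j + 1 by omega]
      refine h1.congr fun u hu => ?_
      have : 0 ≤ s j := hs0 ▸ hs (Nat.zero_le _)
      exact Path.extend_trans_of_half_le _ _ (by linarith [hu.1])

theorem PiecewiseSmooth.integral_trans {p : Path a b} {q : Path b c} (hp : PiecewiseSmooth p)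
    (hq : PiecewiseSmooth q) {f : ℂ → E} (hf : ContinuousOn f (range p ∪ range q)) :
    pathIntegral (p.trans q) f = pathIntegral p f + pathIntegral q f :=
  curveIntegral_trans (hp.curveIntegrable (hf.mono subset_union_left))
    (hq.curveIntegrable (hf.mono subset_union_right))

theorem pathIntegral_segment (a b : ℂ) (f : ℂ → E) :
    pathIntegral (Path.segment a b) f = ∫ t in (0 : ℝ)..1, (b - a) • f (a + t * (b - a)) := by
  rw [pathIntegral, curveIntegral_segment]
  congr with t
  simp [AffineMap.lineMap_apply, add_comm]

/-- The fundamental theorem of calculus along a segment. -/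
theorem pathIntegral_segment_of_hasDerivAt [CompleteSpace E] {F f : ℂ → E}
    (hF : ∀ z ∈ segment ℝ a b, HasDerivAt F (f z) z) (hf : ContinuousOn f (segment ℝ a b)) :
    pathIntegral (Path.segment a b) f = F b - F a := by
  have hmem : ∀ t ∈ Icc (0 : ℝ) 1, a + t * (b - a) ∈ segment ℝ a b := fun t ht => by
    rw [segment_eq_image']
    exact ⟨t, ht, by simp⟩
  rw [pathIntegral_segment, intervalIntegral.integral_eq_sub_of_hasDerivAt
    (f := fun t : ℝ => F (a + t * (b - a)))]
  · simp
  · intro t ht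
    rw [uIcc_of_le zero_le_one] at ht
    have h1 : HasDerivAt (fun t : ℝ => a + t * (b - a)) (b - a) t := by
      simpa using ((Complex.ofRealCLM.hasDerivAt (x := t)).mul_const (b - a)).const_add a
    exact (hF _ (hmem t ht)).scomp t h1
  · refine ContinuousOn.intervalIntegrable ?_
    rw [uIcc_of_le zero_le_one]
    exact continuousOn_const.smul (hf.comp (by fun_prop) hmem)

end PathIntegral

/-! ### Cauchy's integral formula for rectangles -/

section Rectangle

open MeasureTheory Set Complex

variable {E : Type*} [NormedAddCommGroup E] [NormedSpace ℂ E]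

theorem pathIntegral_segment_horizontal (x₀ x₁ y : ℝ) (f : ℂ → E) :
    pathIntegral (Path.segment (⟨x₀, y⟩ : ℂ) ⟨x₁, y⟩) f = ∫ x in x₀..x₁, f (x + y * I) := by
  have h := intervalIntegral.smul_integral_comp_add_mul (fun x : ℝ => f (x + y * I)) (x₁ - x₀) x₀
    (a := 0) (b := 1)
  simp only [mul_zero, add_zero, mul_one, add_sub_cancel] at h
  rw [pathIntegral_segment, ← h, ← intervalIntegral.integral_smul]
  congr with t
  rw [← Complex.coe_smul]
  congr 1
  · apply Complex.ext <;> simp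
  · congr 1
    apply Complex.ext <;> simp [mul_comm]

theorem pathIntegral_segment_vertical (x y₀ y₁ : ℝ) (f : ℂ → E) :
    pathIntegral (Path.segment (⟨x, y₀⟩ : ℂ) ⟨x, y₁⟩) f = I • ∫ y in y₀..y₁, f (x + y * I) := by
  have h := intervalIntegral.smul_integral_comp_add_mul (fun y : ℝ => f (x + y * I)) (y₁ - y₀) y₀
    (a := 0) (b := 1)
  simp only [mul_zero, add_zero, mul_one, add_sub_cancel] at h
  rw [pathIntegral_segment, ← h, ← intervalIntegral.integral_smul, ← intervalIntegral.integral_smul]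
  congr with t
  rw [← Complex.coe_smul, smul_smul]
  congr 1
  · apply Complex.ext <;> simp
  · congr 1
    apply Complex.ext <;> simp [mul_comm]

theorem pathIntegral_segment_swap (a b : ℂ) (f : ℂ → E) :
    pathIntegral (Path.segment b a) f = -pathIntegral (Path.segment a b) f := by
  rw [← Path.segment_symm, pathIntegral_symm]

/-- The integral over the positively oriented boundary of `[x₀, x₁] × [y₀, y₁]`. -/
def rectIntegral (x₀ x₁ y₀ y₁ : ℝ) (f : ℂ → E) : E :=
  pathIntegral (Path.segment (⟨x₀, y₀⟩ : ℂ) ⟨x₁, y₀⟩) f +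
    pathIntegral (Path.segment (⟨x₁, y₀⟩ : ℂ) ⟨x₁, y₁⟩) f +
    pathIntegral (Path.segment (⟨x₁, y₁⟩ : ℂ) ⟨x₀, y₁⟩) f +
    pathIntegral (Path.segment (⟨x₀, y₁⟩ : ℂ) ⟨x₀, y₀⟩) f

theorem rectIntegral_eq_zero {x₀ x₁ y₀ y₁ : ℝ} (hx : x₀ ≤ x₁) (hy : y₀ ≤ y₁) {f : ℂ → E}
    (hf : DifferentiableOn ℂ f (Icc x₀ x₁ ×ℂ Icc y₀ y₁)) : rectIntegral x₀ x₁ y₀ y₁ f = 0 := by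
  have h := integral_boundary_rect_eq_zero_of_differentiableOn f ⟨x₀, y₀⟩ ⟨x₁, y₁⟩
    (by simpa [uIcc_of_le hx, uIcc_of_le hy] using hf)
  rw [rectIntegral, pathIntegral_segment_swap ⟨x₀, y₁⟩ ⟨x₁, y₁⟩,
    pathIntegral_segment_swap ⟨x₀, y₀⟩ ⟨x₀, y₁⟩, pathIntegral_segment_horizontal,
    pathIntegral_segment_horizontal, pathIntegral_segment_vertical, pathIntegral_segment_vertical,
    ← h]
  abel

theorem segment_subset_of_re {a b : ℂ} {s : Set ℝ} (hs : Convex ℝ s) (ha : a.re ∈ s)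
    (hb : b.re ∈ s) : ∀ w ∈ segment ℝ a b, w.re ∈ s := fun _ hw =>
  (hs.linear_preimage Complex.reLm).segment_subset (x := a) (y := b) ha hb hw

theorem segment_subset_of_im {a b : ℂ} {s : Set ℝ} (hs : Convex ℝ s) (ha : a.im ∈ s)
    (hb : b.im ∈ s) : ∀ w ∈ segment ℝ a b, w.im ∈ s := fun _ hw =>
  (hs.linear_preimage Complex.imLm).segment_subset (x := a) (y := b) ha hb hw

theorem pathIntegral_segment_inv_sub {a b z : ℂ} (h : ∀ w ∈ segment ℝ a b, w - z ∈ slitPlane) :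
    pathIntegral (Path.segment a b) (fun w => (w - z)⁻¹) = log (b - z) - log (a - z) := by
  refine pathIntegral_segment_of_hasDerivAt (F := fun w => log (w - z)) (fun w hw => ?_) ?_
  · simpa using ((hasDerivAt_id w).sub_const z).clog (h w hw)
  · exact (continuousOn_id.sub continuousOn_const).inv₀ fun w hw => slitPlane_ne_zero (h w hw)

/-- The primitive log (z - w) has its cut to the right of z, so it is available on the left side of
a rectangle around z. -/
theorem pathIntegral_segment_inv_sub_of_neg {a b z : ℂ}
    (h : ∀ w ∈ segment ℝ a b, z - w ∈ slitPlane) :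
    pathIntegral (Path.segment a b) (fun w => (w - z)⁻¹) = log (z - b) - log (z - a) := by
  refine pathIntegral_segment_of_hasDerivAt (F := fun w => log (z - w)) (fun w hw => ?_) ?_
  · have h1 := ((hasDerivAt_id w).const_sub z).clog (h w hw)
    rwa [show -1 / (z - id w) = (w - z)⁻¹ by
      rw [← neg_sub z w, inv_neg, id, neg_div, one_div]] at h1
  · refine (continuousOn_id.sub continuousOn_const).inv₀ fun w hw h0 => ?_
    refine slitPlane_ne_zero (h w hw) ?_
    rw [← neg_sub, neg_eq_zero]
    exact h0

/-- The primitive log (w - z) works on the lower, right and upper sides; the left side crosses its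
cut and needs log (z - w). The second logarithm exceeds the first by πi at the lower left corner and
by -πi at the upper left one; this mismatch is the value 2πi. -/
theorem rectIntegral_inv_sub {x₀ x₁ y₀ y₁ : ℝ} {z : ℂ} (hx₀ : x₀ < z.re) (hx₁ : z.re < x₁)
    (hy₀ : y₀ < z.im) (hy₁ : z.im < y₁) :
    rectIntegral x₀ x₁ y₀ y₁ (fun w => (w - z)⁻¹) = 2 * Real.pi * I := by
  rw [rectIntegral, pathIntegral_segment_inv_sub, pathIntegral_segment_inv_sub,
    pathIntegral_segment_inv_sub, pathIntegral_segment_inv_sub_of_neg]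
  · have h1 : log (z - ⟨x₀, y₀⟩) = log (⟨x₀, y₀⟩ - z) + Real.pi * I := by
      rw [← neg_sub, log, log, norm_neg, arg_neg_eq_arg_add_pi_of_im_neg (by simpa using hy₀)]
      push_cast
      ring
    have h2 : log (z - ⟨x₀, y₁⟩) = log (⟨x₀, y₁⟩ - z) - Real.pi * I := by
      rw [← neg_sub, log, log, norm_neg, arg_neg_eq_arg_sub_pi_of_im_pos (by simpa using hy₁)]
      push_cast
      ring
    rw [h1, h2]
    ring
  · intro w hw
    have := segment_subset_of_re (convex_Iio z.re) (by simpa using hx₀) (by simpa using hx₀) w hw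
    exact Or.inl (by simpa using this)
  · intro w hw
    have := segment_subset_of_im (convex_Ioi z.im) (by simpa using hy₁) (by simpa using hy₁) w hw
    exact Or.inr (by simpa [sub_eq_zero] using ne_of_gt this)
  · intro w hw
    have := segment_subset_of_re (convex_Ioi z.re) (by simpa using hx₁) (by simpa using hx₁) w hw
    exact Or.inl (by simpa using this)
  · intro w hw
    have := segment_subset_of_im (convex_Iio z.im) (by simpa using hy₀) (by simpa using hy₀) w hw
    exact Or.inr (by simpa [sub_eq_zero] using ne_of_lt this)

/-- The difference quotient `dslope f z` is differentiable across z, so its integral vanishes; off z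
it differs from f(w)/(w - z) by f(z)/(w - z). -/
theorem rectIntegral_inv_sub_smul [CompleteSpace E] {x₀ x₁ y₀ y₁ : ℝ} {z : ℂ} (hx₀ : x₀ < z.re)
    (hx₁ : z.re < x₁) (hy₀ : y₀ < z.im) (hy₁ : z.im < y₁) {f : ℂ → E}
    (hf : DifferentiableOn ℂ f (Icc x₀ x₁ ×ℂ Icc y₀ y₁)) :
    rectIntegral x₀ x₁ y₀ y₁ (fun w => (w - z)⁻¹ • f w) = (2 * Real.pi * I : ℂ) • f z := by
  have hnhds : Icc x₀ x₁ ×ℂ Icc y₀ y₁ ∈ nhds z := by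
    refine Filter.inter_mem ?_ ?_
    · exact continuous_re.continuousAt (Icc_mem_nhds hx₀ hx₁)
    · exact continuous_im.continuousAt (Icc_mem_nhds hy₀ hy₁)
  have hd := (differentiableOn_dslope hnhds).2 hf
  have h0 := rectIntegral_eq_zero (hx₀.trans hx₁).le (hy₀.trans hy₁).le hd
  have hx := (hx₀.trans hx₁).le
  have hy := (hy₀.trans hy₁).le
  have key : ∀ a b : ℂ, segment ℝ a b ⊆ Icc x₀ x₁ ×ℂ Icc y₀ y₁ → z ∉ segment ℝ a b →
      pathIntegral (Path.segment a b) (fun w => (w - z)⁻¹ • f w) =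
        pathIntegral (Path.segment a b) (dslope f z) +
        pathIntegral (Path.segment a b) (fun w => (w - z)⁻¹) • f z := by
    intro a b hsub hz
    have hne : ∀ w ∈ segment ℝ a b, w - z ≠ 0 := fun w hw h =>
      hz (by rwa [← sub_eq_zero.1 h])
    rw [← pathIntegral_smul_const, ← (piecewiseSmooth_segment a b).integral_add]
    · refine pathIntegral_congr _ fun w hw => ?_
      rw [Path.range_segment] at hw
      rw [dslope_of_ne _ (fun h => hne w hw (by rw [h, sub_self])), slope_def_module]
      module
    · rw [Path.range_segment]
      exact hd.continuousOn.mono hsub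
    · rw [Path.range_segment]
      exact ((continuousOn_id.sub continuousOn_const).inv₀ hne).smul continuousOn_const
  have hsub : ∀ a b : ℂ, a ∈ Icc x₀ x₁ ×ℂ Icc y₀ y₁ → b ∈ Icc x₀ x₁ ×ℂ Icc y₀ y₁ →
      segment ℝ a b ⊆ Icc x₀ x₁ ×ℂ Icc y₀ y₁ := fun a b ha hb w hw =>
    ⟨segment_subset_of_re (convex_Icc _ _) ha.1 hb.1 w hw,
      segment_subset_of_im (convex_Icc _ _) ha.2 hb.2 w hw⟩
  have h00 : (⟨x₀, y₀⟩ : ℂ) ∈ Icc x₀ x₁ ×ℂ Icc y₀ y₁ := ⟨⟨le_rfl, hx⟩, ⟨le_rfl, hy⟩⟩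
  have h10 : (⟨x₁, y₀⟩ : ℂ) ∈ Icc x₀ x₁ ×ℂ Icc y₀ y₁ := ⟨⟨hx, le_rfl⟩, ⟨le_rfl, hy⟩⟩
  have h11 : (⟨x₁, y₁⟩ : ℂ) ∈ Icc x₀ x₁ ×ℂ Icc y₀ y₁ := ⟨⟨hx, le_rfl⟩, ⟨hy, le_rfl⟩⟩
  have h01 : (⟨x₀, y₁⟩ : ℂ) ∈ Icc x₀ x₁ ×ℂ Icc y₀ y₁ := ⟨⟨le_rfl, hx⟩, ⟨hy, le_rfl⟩⟩
  rw [← rectIntegral_inv_sub hx₀ hx₁ hy₀ hy₁, rectIntegral, key _ _ (hsub _ _ h00 h10),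
    key _ _ (hsub _ _ h10 h11), key _ _ (hsub _ _ h11 h01), key _ _ (hsub _ _ h01 h00)]
  · rw [rectIntegral] at h0 ⊢
    rw [← sub_eq_zero, ← h0]
    module
  · exact fun h => lt_irrefl z.re
      (segment_subset_of_re (convex_Iio z.re) (by simpa using hx₀) (by simpa using hx₀) z h)
  · exact fun h => lt_irrefl z.im
      (segment_subset_of_im (convex_Ioi z.im) (by simpa using hy₁) (by simpa using hy₁) z h)
  · exact fun h => lt_irrefl z.re
      (segment_subset_of_re (convex_Ioi z.re) (by simpa using hx₁) (by simpa using hx₁) z h)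
  · exact fun h => lt_irrefl z.im
      (segment_subset_of_im (convex_Iio z.im) (by simpa using hy₀) (by simpa using hy₀) z h)

end Rectangle

/-! ### Unions of squares of a grid -/

section Grid

open MeasureTheory Set Complex

/-- The closed square with side `δ` and lower left corner `δ (s.1 + i s.2)`. -/
def gridCell (δ : ℝ) (s : ℤ × ℤ) : Set ℂ :=
  Icc (δ * s.1) (δ * (s.1 + 1)) ×ℂ Icc (δ * s.2) (δ * (s.2 + 1))

/-- The open square with side `δ` and lower left corner `δ (s.1 + i s.2)`. -/
def openGridCell (δ : ℝ) (s : ℤ × ℤ) : Set ℂ :=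
  Ioo (δ * s.1) (δ * (s.1 + 1)) ×ℂ Ioo (δ * s.2) (δ * (s.2 + 1))

/-- The lower edge of a grid square, oriented positively. -/
def bottomEdge (δ : ℝ) (s : ℤ × ℤ) : ℂ × ℂ :=
  (⟨δ * s.1, δ * s.2⟩, ⟨δ * (s.1 + 1), δ * s.2⟩)

/-- The right edge of a grid square, oriented positively. -/
def rightEdge (δ : ℝ) (s : ℤ × ℤ) : ℂ × ℂ :=
  (⟨δ * (s.1 + 1), δ * s.2⟩, ⟨δ * (s.1 + 1), δ * (s.2 + 1)⟩)

/-- The upper edge of a grid square, oriented positively. -/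
def topEdge (δ : ℝ) (s : ℤ × ℤ) : ℂ × ℂ :=
  (⟨δ * (s.1 + 1), δ * (s.2 + 1)⟩, ⟨δ * s.1, δ * (s.2 + 1)⟩)

/-- The left edge of a grid square, oriented positively. -/
def leftEdge (δ : ℝ) (s : ℤ × ℤ) : ℂ × ℂ :=
  (⟨δ * s.1, δ * (s.2 + 1)⟩, ⟨δ * s.1, δ * s.2⟩)

/-- The positively oriented boundary edges of a finite union of grid squares. -/
def gridEdges (δ : ℝ) (S : Finset (ℤ × ℤ)) : Multiset (ℂ × ℂ) :=
  (S.filter fun s => s + (0, 1) ∉ S).val.map (topEdge δ) +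
    (S.filter fun s => s - (0, 1) ∉ S).val.map (bottomEdge δ) +
    ((S.filter fun s => s + (1, 0) ∉ S).val.map (rightEdge δ) +
    (S.filter fun s => s - (1, 0) ∉ S).val.map (leftEdge δ))

/-- The union of the squares of `S`. -/
def gridUnion (δ : ℝ) (S : Finset (ℤ × ℤ)) : Set ℂ := ⋃ s ∈ S, gridCell δ s

/-- The interior of the union of the squares of `S`. -/
def gridInterior (δ : ℝ) (S : Finset (ℤ × ℤ)) : Set ℂ := (⋃ s : {s // s ∉ S}, gridCell δ s)ᶜ

/-- A side shared by s and s + e, both in S, contributes u s + v (s + e) = 0, so dropping the shared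
sides changes nothing. -/
theorem sum_filter_add_sum_filter {G A : Type*} [AddCommGroup G] [DecidableEq G] [AddCommGroup A]
    (S : Finset G) (e : G) (u v : G → A) (h : ∀ s, u s = -v (s + e)) :
    ∑ s ∈ S with s + e ∉ S, u s + ∑ s ∈ S with s - e ∉ S, v s = ∑ s ∈ S, u s + ∑ s ∈ S, v s := by
  rw [← Finset.sum_filter_add_sum_filter_not S (fun s => s + e ∈ S) u,
    ← Finset.sum_filter_add_sum_filter_not S (fun s => s - e ∈ S) v]
  have : ∑ s ∈ S with s + e ∈ S, u s = -∑ s ∈ S with s - e ∈ S, v s := by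
    rw [← Finset.sum_neg_distrib]
    refine Finset.sum_nbij' (fun s => s + e) (fun s => s - e) ?_ ?_ ?_ ?_ ?_ <;>
      simp +contextual [h]
  rw [this]
  abel

/-- Inner edges cancel. -/
theorem sum_gridEdges {A : Type*} [AddCommGroup A] (δ : ℝ) (S : Finset (ℤ × ℤ)) (g : ℂ × ℂ → A)
    (hg : ∀ a b, g (a, b) = -g (b, a)) :
    ((gridEdges δ S).map g).sum = ∑ s ∈ S, (g (bottomEdge δ s) + g (rightEdge δ s) +
      g (topEdge δ s) + g (leftEdge δ s)) := by
  have h1 := sum_filter_add_sum_filter S (0, 1) (fun s => g (topEdge δ s))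
    (fun s => g (bottomEdge δ s)) fun s => by
      rw [topEdge, hg, bottomEdge]
      simp
  have h2 := sum_filter_add_sum_filter S (1, 0) (fun s => g (rightEdge δ s))
    (fun s => g (leftEdge δ s)) fun s => by
      rw [rightEdge, hg, leftEdge]
      simp
  simp only [Finset.sum_add_distrib]
  simp only [gridEdges, Multiset.map_add, Multiset.map_map, Multiset.sum_add]
  refine (congrArg₂ (· + ·) h1 h2).trans ?_
  abel

/-- Every vertex is the starting point and the end point of equally many boundary edges. -/
theorem map_fst_gridEdges (δ : ℝ) (S : Finset (ℤ × ℤ)) :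
    (gridEdges δ S).map Prod.fst = (gridEdges δ S).map Prod.snd := by
  classical
  ext v
  -- Multiplicities become sums of the indicator of `v`, with integer values so that they can be
  -- subtracted.
  obtain ⟨c, hc⟩ : ∃ c : ℂ → ℤ, ∀ w, c w = if v = w then 1 else 0 := ⟨_, fun _ => rfl⟩
  have hcount : ∀ f : ℂ × ℂ → ℂ, (((gridEdges δ S).map f).count v : ℤ) =
      ((gridEdges δ S).map fun e => c (f e)).sum := fun f => by
    induction gridEdges δ S using Multiset.induction_on with
    | empty => simp
    | cons e E ih => simp [Multiset.count_cons, ih, hc, add_comm]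
  -- The increment of the indicator along an edge is odd under reversal and sums to zero around each
  -- square.
  have h := sum_gridEdges δ S (fun e => c e.2 - c e.1) (by simp)
  rw [Finset.sum_eq_zero (fun s _ => by simp only [bottomEdge, rightEdge, topEdge, leftEdge]; ring),
    Multiset.sum_map_sub, sub_eq_zero] at h
  exact_mod_cast (hcount _).trans (h.symm.trans (hcount _).symm)

variable {δ : ℝ}

theorem exists_mem_gridCell (hδ : 0 < δ) (z : ℂ) : ∃ s, z ∈ gridCell δ s := by
  have key : ∀ x : ℝ, δ * ⌊x / δ⌋ ≤ x ∧ x ≤ δ * (⌊x / δ⌋ + 1) := fun x => by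
    have h1 := Int.floor_le (x / δ)
    have h2 := (Int.lt_floor_add_one (x / δ)).le
    rw [le_div_iff₀ hδ] at h1
    rw [div_le_iff₀ hδ] at h2
    constructor <;> linarith
  exact ⟨(⌊z.re / δ⌋, ⌊z.im / δ⌋), key _, key _⟩

/-- A square meeting the ball of radius δ about z has indices within 2 of `⌊z.re / δ⌋` and `⌊z.im /
δ⌋`. -/
theorem locallyFinite_gridCell (hδ : 0 < δ) : LocallyFinite (gridCell δ) := by
  intro z
  refine ⟨Metric.ball z δ, Metric.ball_mem_nhds z hδ, ?_⟩
  have key : ∀ (x y : ℝ) (i : ℤ), |x - y| < δ → δ * i ≤ x → x ≤ δ * (i + 1) →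
      ⌊y / δ⌋ - 2 ≤ i ∧ i ≤ ⌊y / δ⌋ + 2 := by
    intro x y i hxy h1 h2
    have h3 := Int.floor_le (y / δ)
    have h4 := Int.lt_floor_add_one (y / δ)
    rw [le_div_iff₀ hδ] at h3
    rw [div_lt_iff₀ hδ] at h4
    rw [abs_lt] at hxy
    have h5 : (⌊y / δ⌋ : ℝ) < i + 2 := by
      refine lt_of_mul_lt_mul_left ?_ hδ.le
      nlinarith
    have h6 : (i : ℝ) < ⌊y / δ⌋ + 2 := by
      refine lt_of_mul_lt_mul_left ?_ hδ.le
      nlinarith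
    have h5' : ⌊y / δ⌋ < i + 2 := by exact_mod_cast h5
    have h6' : i < ⌊y / δ⌋ + 2 := by exact_mod_cast h6
    omega
  refine (finite_Icc ((⌊z.re / δ⌋ - 2, ⌊z.im / δ⌋ - 2) : ℤ × ℤ)
    (⌊z.re / δ⌋ + 2, ⌊z.im / δ⌋ + 2)).subset ?_
  rintro s ⟨w, ⟨hre, him⟩, hball⟩
  rw [Metric.mem_ball, dist_eq_norm] at hball
  have h1 := key w.re z.re s.1 ((abs_re_le_norm (w - z)).trans_lt hball) hre.1 hre.2
  have h2 := key w.im z.im s.2 ((abs_im_le_norm (w - z)).trans_lt hball) him.1 him.2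
  exact ⟨⟨h1.1, h2.1⟩, ⟨h1.2, h2.2⟩⟩

theorem isClosed_gridCell (δ : ℝ) (s : ℤ × ℤ) : IsClosed (gridCell δ s) :=
  isClosed_Icc.reProdIm isClosed_Icc

theorem isOpen_gridInterior (hδ : 0 < δ) (S : Finset (ℤ × ℤ)) : IsOpen (gridInterior δ S) :=
  (((locallyFinite_gridCell hδ).comp_injective Subtype.val_injective).isClosed_iUnion
    fun s => isClosed_gridCell δ s.1).isOpen_compl

theorem isClosed_gridUnion (δ : ℝ) (S : Finset (ℤ × ℤ)) : IsClosed (gridUnion δ S) :=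
  S.finite_toSet.isClosed_biUnion fun s _ => isClosed_gridCell δ s

theorem isCompact_gridCell (δ : ℝ) (s : ℤ × ℤ) : IsCompact (gridCell δ s) :=
  isCompact_Icc.reProdIm isCompact_Icc

theorem isCompact_gridUnion (δ : ℝ) (S : Finset (ℤ × ℤ)) : IsCompact (gridUnion δ S) :=
  S.finite_toSet.isCompact_biUnion fun s _ => isCompact_gridCell δ s

theorem mem_gridInterior {S : Finset (ℤ × ℤ)} {z : ℂ} :
    z ∈ gridInterior δ S ↔ ∀ s, z ∈ gridCell δ s → s ∈ S := by
  simp only [gridInterior, mem_compl_iff, mem_iUnion, Subtype.exists, not_exists]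
  exact ⟨fun h s hs => by_contra fun hn => h s hn hs, fun h s hn hs => hn (h s hs)⟩

theorem mem_gridUnion {S : Finset (ℤ × ℤ)} {z : ℂ} :
    z ∈ gridUnion δ S ↔ ∃ s ∈ S, z ∈ gridCell δ s := by
  simp [gridUnion]

theorem closure_openGridCell (hδ : 0 < δ) (s : ℤ × ℤ) :
    closure (openGridCell δ s) = gridCell δ s := by
  have h : ∀ i : ℤ, δ * i ≠ δ * (i + 1) := fun i => by nlinarith
  rw [openGridCell, closure_reProdIm, closure_Ioo (h _), closure_Ioo (h _), gridCell]

theorem int_eq_of_mem_Ioo (hδ : 0 < δ) {i i' : ℤ} {x : ℝ} (h : x ∈ Ioo (δ * i) (δ * (i + 1)))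
    (h' : x ∈ Icc (δ * i') (δ * (i' + 1))) : i' = i := by
  have h1 : (i : ℝ) < i' + 1 := lt_of_mul_lt_mul_left (h.1.trans_le h'.2) hδ.le
  have h2 : (i' : ℝ) < i + 1 := lt_of_mul_lt_mul_left (h'.1.trans_lt h.2) hδ.le
  have h1' : i < i' + 1 := by exact_mod_cast h1
  have h2' : i' < i + 1 := by exact_mod_cast h2
  omega

theorem eq_of_mem_openGridCell (hδ : 0 < δ) {s s' : ℤ × ℤ} {z : ℂ} (h : z ∈ openGridCell δ s)
    (h' : z ∈ gridCell δ s') : s' = s :=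
  Prod.ext (int_eq_of_mem_Ioo hδ h.1 h'.1) (int_eq_of_mem_Ioo hδ h.2 h'.2)

theorem openGridCell_subset_gridInterior (hδ : 0 < δ) {S : Finset (ℤ × ℤ)} {s : ℤ × ℤ}
    (hs : s ∈ S) : openGridCell δ s ⊆ gridInterior δ S := fun z hz =>
  mem_gridInterior.2 fun s' hs' => by rwa [eq_of_mem_openGridCell hδ hz hs']

theorem gridInterior_subset_gridUnion (hδ : 0 < δ) (S : Finset (ℤ × ℤ)) :
    gridInterior δ S ⊆ gridUnion δ S := fun z hz => by
  obtain ⟨s, hs⟩ := exists_mem_gridCell hδ z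
  exact mem_gridUnion.2 ⟨s, mem_gridInterior.1 hz s hs, hs⟩

/-- An open square meets no closed square but its own, so for s in S it lies in the interior, and
its closure is the closed square. -/
theorem closure_gridInterior (hδ : 0 < δ) (S : Finset (ℤ × ℤ)) :
    closure (gridInterior δ S) = gridUnion δ S := by
  refine subset_antisymm
    (closure_minimal (gridInterior_subset_gridUnion hδ S) (isClosed_gridUnion δ S)) ?_
  intro z hz
  obtain ⟨s, hs, hzs⟩ := mem_gridUnion.1 hz
  rw [← closure_openGridCell hδ] at hzs
  exact closure_mono (openGridCell_subset_gridInterior hδ hs) hzs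

theorem segment_horizontal {x₀ x₁ : ℝ} (h : x₀ < x₁) (y : ℝ) :
    segment ℝ (⟨x₀, y⟩ : ℂ) ⟨x₁, y⟩ = Icc x₀ x₁ ×ℂ {y} := by
  refine subset_antisymm (fun w hw => ⟨segment_subset_of_re (convex_Icc _ _)
    (left_mem_Icc.2 h.le) (right_mem_Icc.2 h.le) w hw,
    segment_subset_of_im (convex_singleton y) (mem_singleton _) (mem_singleton _) w hw⟩) ?_
  rintro w ⟨hre, him⟩
  have h0 : 0 < x₁ - x₀ := sub_pos.2 h
  rw [segment_eq_image']
  refine ⟨(w.re - x₀) / (x₁ - x₀), ⟨div_nonneg (sub_nonneg.2 hre.1) h0.le,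
    (div_le_one h0).2 (by linarith [hre.2])⟩, ?_⟩
  apply Complex.ext
  · simp only [add_re, Complex.smul_re, sub_re, smul_eq_mul]
    field_simp
    ring
  · simp only [add_im, Complex.smul_im, sub_im, sub_self, smul_zero, add_zero]
    exact him.symm

theorem segment_vertical {y₀ y₁ : ℝ} (h : y₀ < y₁) (x : ℝ) :
    segment ℝ (⟨x, y₀⟩ : ℂ) ⟨x, y₁⟩ = {x} ×ℂ Icc y₀ y₁ := by
  refine subset_antisymm (fun w hw => ⟨segment_subset_of_re (convex_singleton x)
    (mem_singleton _) (mem_singleton _) w hw,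
    segment_subset_of_im (convex_Icc _ _)
    (left_mem_Icc.2 h.le) (right_mem_Icc.2 h.le) w hw⟩) ?_
  rintro w ⟨hre, him⟩
  have h0 : 0 < y₁ - y₀ := sub_pos.2 h
  rw [segment_eq_image']
  refine ⟨(w.im - y₀) / (y₁ - y₀), ⟨div_nonneg (sub_nonneg.2 him.1) h0.le,
    (div_le_one h0).2 (by linarith [him.2])⟩, ?_⟩
  apply Complex.ext
  · simp only [add_re, Complex.smul_re, sub_re, sub_self, smul_zero, add_zero]
    exact hre.symm
  · simp only [add_im, Complex.smul_im, sub_im, smul_eq_mul]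
    field_simp
    ring

/-- Distinct closed grid intervals meet only if they are neighbours, and then in their common end
point; this finds the side on which a boundary point lies. -/
theorem int_adjacent (hδ : 0 < δ) {j j' : ℤ} {y : ℝ} (hne : j ≠ j')
    (h : y ∈ Icc (δ * j) (δ * (j + 1))) (h' : y ∈ Icc (δ * j') (δ * (j' + 1))) :
    (j' = j - 1 ∧ y = δ * j) ∨ (j' = j + 1 ∧ y = δ * (j + 1)) := by
  have h1 : (j : ℝ) ≤ j' + 1 := le_of_mul_le_mul_left (h.1.trans h'.2) hδ
  have h2 : (j' : ℝ) ≤ j + 1 := le_of_mul_le_mul_left (h'.1.trans h.2) hδ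
  have h1' : j ≤ j' + 1 := by exact_mod_cast h1
  have h2' : j' ≤ j + 1 := by exact_mod_cast h2
  have h3 : j' = j - 1 ∨ j' = j + 1 := by omega
  rcases h3 with rfl | rfl
  · refine Or.inl ⟨rfl, le_antisymm ?_ h.1⟩
    simpa using h'.2
  · refine Or.inr ⟨rfl, le_antisymm h.2 ?_⟩
    simpa using h'.1

theorem segment_bottomEdge (hδ : 0 < δ) (s : ℤ × ℤ) :
    segment ℝ (bottomEdge δ s).1 (bottomEdge δ s).2 =
      Icc (δ * s.1) (δ * (s.1 + 1)) ×ℂ {δ * s.2} :=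
  segment_horizontal (by nlinarith) _

theorem segment_topEdge (hδ : 0 < δ) (s : ℤ × ℤ) :
    segment ℝ (topEdge δ s).1 (topEdge δ s).2 =
      Icc (δ * s.1) (δ * (s.1 + 1)) ×ℂ {δ * (s.2 + 1)} := by
  rw [segment_symm]
  exact segment_horizontal (by nlinarith) _

theorem segment_rightEdge (hδ : 0 < δ) (s : ℤ × ℤ) :
    segment ℝ (rightEdge δ s).1 (rightEdge δ s).2 =
      {δ * (s.1 + 1)} ×ℂ Icc (δ * s.2) (δ * (s.2 + 1)) :=
  segment_vertical (by nlinarith) _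

theorem segment_leftEdge (hδ : 0 < δ) (s : ℤ × ℤ) :
    segment ℝ (leftEdge δ s).1 (leftEdge δ s).2 =
      {δ * s.1} ×ℂ Icc (δ * s.2) (δ * (s.2 + 1)) := by
  rw [segment_symm]
  exact segment_vertical (by nlinarith) _

theorem mem_gridEdges {S : Finset (ℤ × ℤ)} {e : ℂ × ℂ} : e ∈ gridEdges δ S ↔ ∃ s ∈ S,
    (s + (0, 1) ∉ S ∧ topEdge δ s = e) ∨ (s - (0, 1) ∉ S ∧ bottomEdge δ s = e) ∨
    (s + (1, 0) ∉ S ∧ rightEdge δ s = e) ∨ (s - (1, 0) ∉ S ∧ leftEdge δ s = e) := by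
  simp only [gridEdges, Multiset.mem_add, Multiset.mem_map, Finset.mem_val, Finset.mem_filter]
  constructor
  · rintro ((⟨s, h, rfl⟩ | ⟨s, h, rfl⟩) | (⟨s, h, rfl⟩ | ⟨s, h, rfl⟩)) <;>
      exact ⟨s, h.1, by simp [h.2]⟩
  · rintro ⟨s, hs, ⟨h, rfl⟩ | ⟨h, rfl⟩ | ⟨h, rfl⟩ | ⟨h, rfl⟩⟩
    · exact Or.inl (Or.inl ⟨s, ⟨hs, h⟩, rfl⟩)
    · exact Or.inl (Or.inr ⟨s, ⟨hs, h⟩, rfl⟩)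
    · exact Or.inr (Or.inl ⟨s, ⟨hs, h⟩, rfl⟩)
    · exact Or.inr (Or.inr ⟨s, ⟨hs, h⟩, rfl⟩)

/-- A point of the union off the interior lies in a square of S and in a square outside S. If these
are neighbours, their common side is a boundary edge; squares touching only at a corner are compared
through a third one. -/
theorem exists_mem_segment_gridEdges (hδ : 0 < δ) {S : Finset (ℤ × ℤ)} {z : ℂ} :
    (∃ e ∈ gridEdges δ S, z ∈ segment ℝ e.1 e.2) ↔ z ∈ gridUnion δ S \ gridInterior δ S := by
  have hmem : z ∈ gridUnion δ S \ gridInterior δ S ↔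
      ∃ s ∈ S, z ∈ gridCell δ s ∧ ∃ s' ∉ S, z ∈ gridCell δ s' := by
    rw [mem_sdiff, mem_gridUnion, mem_gridInterior]
    push Not
    constructor
    · rintro ⟨⟨s, hs, hz⟩, s', hz', hs'⟩
      exact ⟨s, hs, hz, s', hs', hz'⟩
    · rintro ⟨s, hs, hz, s', hs', hz'⟩
      exact ⟨⟨s, hs, hz⟩, s', hz', hs'⟩
  rw [hmem]
  have hlt : ∀ i : ℤ, δ * i ≤ δ * (i + 1) := fun i => by nlinarith
  constructor
  · rintro ⟨e, he, hz⟩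
    obtain ⟨s, hs, ⟨h, rfl⟩ | ⟨h, rfl⟩ | ⟨h, rfl⟩ | ⟨h, rfl⟩⟩ := mem_gridEdges.1 he
    · rw [segment_topEdge hδ] at hz
      have hz2 : z.im = δ * (s.2 + 1) := hz.2
      exact ⟨s, hs, ⟨hz.1, by simpa [hz2] using hlt _⟩, _, h, by simpa using hz.1, by
        simpa [hz2] using hlt (s.2 + 1)⟩
    · rw [segment_bottomEdge hδ] at hz
      have hz2 : z.im = δ * s.2 := hz.2
      exact ⟨s, hs, ⟨hz.1, by simpa [hz2] using hlt _⟩, _, h, by simpa using hz.1, by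
        simpa [hz2] using hlt (s.2 - 1)⟩
    · rw [segment_rightEdge hδ] at hz
      have hz2 : z.re = δ * (s.1 + 1) := hz.1
      exact ⟨s, hs, ⟨by simpa [hz2] using hlt _, hz.2⟩, _, h, by
        simpa [hz2] using hlt (s.1 + 1), by simpa using hz.2⟩
    · rw [segment_leftEdge hδ] at hz
      have hz2 : z.re = δ * s.1 := hz.1
      exact ⟨s, hs, ⟨by simpa [hz2] using hlt _, hz.2⟩, _, h, by
        simpa [hz2] using hlt (s.1 - 1), by simpa using hz.2⟩
  · rintro ⟨⟨i, j⟩, hs, hz, ⟨i', j'⟩, hs', hz'⟩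
    -- This square shares a row with the first square and a column with the second, and it also
    -- contains z. Its membership in S decides which of the two moves leaves S.
    by_cases ht : (i', j) ∈ S
    · have hne : j ≠ j' := by rintro rfl; exact hs' ht
      rcases int_adjacent hδ hne hz.2 hz'.2 with ⟨rfl, h⟩ | ⟨rfl, h⟩
      · refine ⟨bottomEdge δ (i', j), mem_gridEdges.2 ⟨_, ht, by simp [hs']⟩, ?_⟩
        rw [segment_bottomEdge hδ]
        exact ⟨hz'.1, h⟩
      · refine ⟨topEdge δ (i', j), mem_gridEdges.2 ⟨_, ht, by simp [hs']⟩, ?_⟩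
        rw [segment_topEdge hδ]
        exact ⟨hz'.1, h⟩
    · have hne : i ≠ i' := by rintro rfl; exact ht hs
      rcases int_adjacent hδ hne hz.1 hz'.1 with ⟨rfl, h⟩ | ⟨rfl, h⟩
      · refine ⟨leftEdge δ (i, j), mem_gridEdges.2 ⟨_, hs, by simp [ht]⟩, ?_⟩
        rw [segment_leftEdge hδ]
        exact ⟨h, hz.2⟩
      · refine ⟨rightEdge δ (i, j), mem_gridEdges.2 ⟨_, hs, by simp [ht]⟩, ?_⟩
        rw [segment_rightEdge hδ]
        exact ⟨h, hz.2⟩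

/-- A compact subset of an open set is surrounded by grid squares inside the open set. -/
theorem exists_grid {K W : Set ℂ} (hK : IsCompact K) (hW : IsOpen W) (hKW : K ⊆ W) :
    ∃ (δ : ℝ) (S : Finset (ℤ × ℤ)), 0 < δ ∧ K ⊆ gridInterior δ S ∧ gridUnion δ S ⊆ W := by
  obtain ⟨r, hr, hrW⟩ := hK.exists_thickening_subset_open hW hKW
  -- Two points of one square are then at distance at most 2r/3 < r, bounding the norm by the sum of
  -- the coordinates.
  have hδ : 0 < r / 3 := by positivity
  have hfin := (locallyFinite_gridCell hδ).finite_nonempty_inter_compact hK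
  refine ⟨r / 3, hfin.toFinset, hδ, fun z hz => mem_gridInterior.2 fun s hs => ?_, fun z hz => ?_⟩
  · rw [Finite.mem_toFinset]
    exact ⟨z, hs, hz⟩
  · obtain ⟨s, hs, hzs⟩ := mem_gridUnion.1 hz
    rw [Finite.mem_toFinset] at hs
    obtain ⟨w, hws, hwK⟩ := hs
    refine hrW (Metric.mem_thickening_iff.2 ⟨w, hwK, ?_⟩)
    rw [dist_eq_norm]
    have h1 : |(z - w).re| ≤ r / 3 := by
      rw [abs_le, sub_re]
      constructor <;> linarith [hzs.1.1, hzs.1.2, hws.1.1, hws.1.2]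
    have h2 : |(z - w).im| ≤ r / 3 := by
      rw [abs_le, sub_im]
      constructor <;> linarith [hzs.2.1, hzs.2.2, hws.2.1, hws.2.2]
    linarith [norm_le_abs_re_add_abs_im (z - w)]

variable {E : Type*} [NormedAddCommGroup E] [NormedSpace ℂ E]

/-- The integral over the positively oriented boundary of a finite union of grid squares. -/
def gridIntegral (δ : ℝ) (S : Finset (ℤ × ℤ)) (f : ℂ → E) : E :=
  ((gridEdges δ S).map fun e => pathIntegral (Path.segment e.1 e.2) f).sum

theorem gridIntegral_eq_sum (δ : ℝ) (S : Finset (ℤ × ℤ)) (f : ℂ → E) :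
    gridIntegral δ S f =
      ∑ s ∈ S, rectIntegral (δ * s.1) (δ * (s.1 + 1)) (δ * s.2) (δ * (s.2 + 1)) f :=
  sum_gridEdges δ S (fun e => pathIntegral (Path.segment e.1 e.2) f)
    fun _ _ => pathIntegral_segment_swap _ _ f

theorem gridIntegral_eq_zero (hδ : 0 < δ) {S : Finset (ℤ × ℤ)} {f : ℂ → E}
    (hf : DifferentiableOn ℂ f (gridUnion δ S)) : gridIntegral δ S f = 0 := by
  rw [gridIntegral_eq_sum]
  refine Finset.sum_eq_zero fun s hs => ?_
  refine rectIntegral_eq_zero (by nlinarith) (by nlinarith) (hf.mono ?_)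
  exact fun z hz => mem_gridUnion.2 ⟨s, hs, hz⟩

theorem differentiableOn_inv_sub_smul {f : ℂ → E} {s : Set ℂ} {z : ℂ}
    (hf : DifferentiableOn ℂ f s) (hz : z ∉ s) :
    DifferentiableOn ℂ (fun w => (w - z)⁻¹ • f w) s := by
  refine DifferentiableOn.smul (DifferentiableOn.inv (by fun_prop) fun w hw h => hz ?_) hf
  rwa [← sub_eq_zero.1 h]

theorem Multiset.differentiableOn_sum {α : Type*} (M : Multiset α) {f : α → ℂ → E} {s : Set ℂ}
    (h : ∀ e ∈ M, DifferentiableOn ℂ (f e) s) :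
    DifferentiableOn ℂ (fun z => (M.map fun e => f e z).sum) s := by
  induction M using Multiset.induction_on with
  | empty => simp
  | cons e M ih =>
    simp only [Multiset.map_cons, Multiset.sum_cons]
    exact (h e (Multiset.mem_cons_self e M)).add
      (ih fun e' he' => h e' (Multiset.mem_cons_of_mem he'))

theorem segment_gridEdges_subset (hδ : 0 < δ) {S : Finset (ℤ × ℤ)} {e : ℂ × ℂ}
    (he : e ∈ gridEdges δ S) :
    segment ℝ e.1 e.2 ⊆ gridUnion δ S \ gridInterior δ S := fun _ hz =>
  (exists_mem_segment_gridEdges hδ).1 ⟨e, he, hz⟩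

/-- Cauchy's integral formula for a finite union of grid squares. -/
theorem gridIntegral_inv_sub_smul [CompleteSpace E] (hδ : 0 < δ) {S : Finset (ℤ × ℤ)} {f : ℂ → E}
    (hf : DifferentiableOn ℂ f (gridUnion δ S)) {z : ℂ} (hz : z ∈ gridInterior δ S) :
    gridIntegral δ S (fun w => (w - z)⁻¹ • f w) = (2 * Real.pi * I : ℂ) • f z := by
  -- For z in an open square only that square contributes; on the others the integrand is analytic.
  have hoff : ∀ s ∈ S, ∀ z ∈ openGridCell δ s,
      gridIntegral δ S (fun w => (w - z)⁻¹ • f w) = (2 * Real.pi * I : ℂ) • f z := by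
    intro s hs z hz
    rw [gridIntegral_eq_sum, Finset.sum_eq_single_of_mem s hs]
    · refine rectIntegral_inv_sub_smul hz.1.1 hz.1.2 hz.2.1 hz.2.2 (hf.mono ?_)
      exact fun z hz => mem_gridUnion.2 ⟨s, hs, hz⟩
    · intro s' hs' hne
      refine rectIntegral_eq_zero (by nlinarith) (by nlinarith)
        (differentiableOn_inv_sub_smul (hf.mono ?_) ?_)
      · exact fun z hz => mem_gridUnion.2 ⟨s', hs', hz⟩
      · exact fun h => hne (eq_of_mem_openGridCell hδ hz h)
  -- Points on inner grid lines are limits from an open square, and both sides of the formula are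
  -- continuous on the grid interior.
  have hcont : ContinuousOn (fun z => gridIntegral δ S (fun w => (w - z)⁻¹ • f w))
      (gridInterior δ S) := by
    refine (Multiset.differentiableOn_sum _ fun e he => ?_).continuousOn
    have hsub := segment_gridEdges_subset hδ he
    refine ((piecewiseSmooth_segment e.1 e.2).differentiableOn_cauchy ?_).mono ?_
    · rw [Path.range_segment]
      exact hf.continuousOn.mono (hsub.trans sdiff_subset)
    · rw [Path.range_segment]
      exact fun z hz hz' => (hsub hz').2 hz
  obtain ⟨s, hs⟩ := exists_mem_gridCell hδ z
  have hsS := mem_gridInterior.1 hz s hs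
  have hopen := (isOpen_gridInterior hδ S).mem_nhds hz
  rw [← closure_openGridCell hδ] at hs
  have : (nhdsWithin z (openGridCell δ s)).NeBot := mem_closure_iff_nhdsWithin_neBot.1 hs
  have h1 : Filter.Tendsto (fun z => gridIntegral δ S (fun w => (w - z)⁻¹ • f w))
      (nhdsWithin z (openGridCell δ s)) (nhds _) :=
    (hcont.continuousAt hopen).mono_left nhdsWithin_le_nhds
  have h2 : Filter.Tendsto (fun z => (2 * Real.pi * I : ℂ) • f z)
      (nhdsWithin z (openGridCell δ s)) (nhds _) :=
    (((hf.mono (gridInterior_subset_gridUnion hδ S)).continuousOn.continuousAt hopen).const_smul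
      (2 * Real.pi * I : ℂ)).mono_left nhdsWithin_le_nhds
  refine tendsto_nhds_unique (h1.congr' ?_) h2
  filter_upwards [self_mem_nhdsWithin] with z hz using hoff s hsS z hz

end Grid

/-! ### Existence of Cauchy domains -/

section Decomposition

open Set

/-- The union of the segments of a family of edges. -/
def edgeUnion (M : Multiset (ℂ × ℂ)) : Set ℂ := ⋃ e ∈ M, segment ℝ e.1 e.2

/-- The sum of the integrals over a family of oriented edges. -/
def edgeIntegral (M : Multiset (ℂ × ℂ)) (f : ℂ → ℂ) : ℂ :=
  (M.map fun e => pathIntegral (Path.segment e.1 e.2) f).sum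

/-- The union of the ranges of a list of curves. -/
def curveUnion (L : List ClosedCurve) : Set ℂ := ⋃ γ ∈ L, range γ.path

/-- The sum of the integrals over a list of curves. -/
def curveSum (L : List ClosedCurve) (f : ℂ → ℂ) : ℂ :=
  (L.map fun γ => pathIntegral γ.path f).sum

theorem edgeUnion_cons (e : ℂ × ℂ) (M : Multiset (ℂ × ℂ)) :
    edgeUnion (e ::ₘ M) = segment ℝ e.1 e.2 ∪ edgeUnion M := by
  ext
  simp [edgeUnion]

theorem edgeIntegral_cons (e : ℂ × ℂ) (M : Multiset (ℂ × ℂ)) (f : ℂ → ℂ) :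
    edgeIntegral (e ::ₘ M) f = pathIntegral (Path.segment e.1 e.2) f + edgeIntegral M f := by
  simp [edgeIntegral]

theorem curveUnion_cons (γ : ClosedCurve) (L : List ClosedCurve) :
    curveUnion (γ :: L) = range γ.path ∪ curveUnion L := by
  ext
  simp [curveUnion]

theorem curveSum_cons (γ : ClosedCurve) (L : List ClosedCurve) (f : ℂ → ℂ) :
    curveSum (γ :: L) f = pathIntegral γ.path f + curveSum L f := by
  simp [curveSum]

/-- The edges `M` can be joined to closed curves. -/
def SplitsIntoCurves (M : Multiset (ℂ × ℂ)) : Prop :=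
  ∃ L : List ClosedCurve, curveUnion L = edgeUnion M ∧
    ∀ f : ℂ → ℂ, ContinuousOn f (edgeUnion M) → curveSum L f = edgeIntegral M f

/-- The edges `M` can be joined to a path from `a` to `b` and closed curves. -/
def SplitsIntoPath (M : Multiset (ℂ × ℂ)) (a b : ℂ) : Prop :=
  ∃ (p : Path a b) (L : List ClosedCurve), PiecewiseSmooth p ∧
    range p ∪ curveUnion L = {a} ∪ edgeUnion M ∧
    ∀ f : ℂ → ℂ, ContinuousOn f ({a} ∪ edgeUnion M) →
      pathIntegral p f + curveSum L f = edgeIntegral M f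

theorem SplitsIntoPath.cons {M : Multiset (ℂ × ℂ)} {a b c : ℂ} (h : SplitsIntoPath M c b) :
    SplitsIntoPath ((a, c) ::ₘ M) a b := by
  obtain ⟨p, L, hp, hU, hI⟩ := h
  have hc : ({c} : Set ℂ) ⊆ segment ℝ a c := singleton_subset_iff.2 (right_mem_segment ℝ a c)
  have ha : ({a} : Set ℂ) ⊆ segment ℝ a c := singleton_subset_iff.2 (left_mem_segment ℝ a c)
  have hs : segment ℝ a c ∪ ({c} ∪ edgeUnion M) = {a} ∪ edgeUnion ((a, c) ::ₘ M) := by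
    rw [edgeUnion_cons, ← union_assoc, union_eq_self_of_subset_right hc, ← union_assoc,
      union_eq_self_of_subset_left ha]
  refine ⟨(Path.segment a c).trans p, L, (piecewiseSmooth_segment a c).trans hp, ?_, ?_⟩
  · rw [Path.trans_range, Path.range_segment, union_assoc, hU, hs]
  · intro f hf
    rw [← hs] at hf
    have hp' : range p ⊆ {c} ∪ edgeUnion M := hU ▸ subset_union_left
    rw [(piecewiseSmooth_segment a c).integral_trans hp
      (hf.mono (by rw [Path.range_segment]; exact union_subset_union_right _ hp')),
      edgeIntegral_cons, add_assoc, hI f (hf.mono subset_union_right)]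

/-- The set `{a}` only accounts for a constant path and is absorbed once an edge passes through a.
-/
theorem SplitsIntoPath.splitsIntoCurves {M : Multiset (ℂ × ℂ)} {a : ℂ} (h : SplitsIntoPath M a a)
    (ha : a ∈ edgeUnion M) : SplitsIntoCurves M := by
  obtain ⟨p, L, hp, hU, hI⟩ := h
  rw [union_eq_self_of_subset_left (singleton_subset_iff.2 ha)] at hU hI
  exact ⟨⟨a, p, hp⟩ :: L, by rw [curveUnion_cons, hU], fun f hf => by rw [curveSum_cons, hI f hf]⟩

theorem splitsIntoCurves_zero : SplitsIntoCurves 0 :=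
  ⟨[], by simp [curveUnion, edgeUnion], by simp [curveSum, edgeIntegral]⟩

theorem SplitsIntoCurves.splitsIntoPath {M : Multiset (ℂ × ℂ)} (h : SplitsIntoCurves M) (a : ℂ) :
    SplitsIntoPath M a a := by
  obtain ⟨L, hU, hI⟩ := h
  refine ⟨Path.refl a, L, PiecewiseSmooth.refl a, by rw [Path.refl_range, hU], fun f hf => ?_⟩
  rw [hI f (hf.mono subset_union_right), pathIntegral, curveIntegral_refl, zero_add]

/-- The hypothesis says that an extra edge from b to a would balance every vertex. If a ≠ b, some
edge therefore leaves a; it becomes the first step, and the other edges satisfy the same hypothesis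
from its end point. If a = b, the path may be constant, and any edge present starts a closed curve.
Each step uses up an edge. -/
theorem splitsIntoPath (M : Multiset (ℂ × ℂ)) (a b : ℂ)
    (h : b ::ₘ M.map Prod.fst = a ::ₘ M.map Prod.snd) : SplitsIntoPath M a b := by
  induction hn : Multiset.card M using Nat.strong_induction_on generalizing M a b with
  | _ n ih =>
    rcases eq_or_ne a b with rfl | hab
    · refine SplitsIntoCurves.splitsIntoPath ?_ a
      rcases Multiset.empty_or_exists_mem M with rfl | ⟨⟨c, d⟩, he⟩
      · exact splitsIntoCurves_zero
      obtain ⟨M', rfl⟩ := Multiset.exists_cons_of_mem he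
      rw [Multiset.cons_inj_right, Multiset.map_cons, Multiset.map_cons] at h
      -- Without the edge (c, d), the remaining edges lead from d back to c.
      refine (ih _ ?_ M' d c h rfl).cons.splitsIntoCurves ?_
      · simp [← hn]
      · rw [edgeUnion_cons]
        exact Or.inl (left_mem_segment ℝ c d)
    · have ha : a ∈ b ::ₘ M.map Prod.fst := h ▸ Multiset.mem_cons_self a _
      obtain ⟨⟨a', c⟩, he, rfl⟩ := Multiset.mem_map.1 ((Multiset.mem_cons.1 ha).resolve_left hab)
      obtain ⟨M', rfl⟩ := Multiset.exists_cons_of_mem he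
      rw [Multiset.map_cons, Multiset.map_cons, Multiset.cons_swap, Multiset.cons_inj_right] at h
      refine (ih _ ?_ M' c b h rfl).cons
      simp [← hn]

/-- A family of oriented edges such that every vertex is the starting point and the end point of
equally many edges can be joined to closed curves. -/
theorem splitsIntoCurves (M : Multiset (ℂ × ℂ)) (h : M.map Prod.fst = M.map Prod.snd) :
    SplitsIntoCurves M := by
  rcases Multiset.empty_or_exists_mem M with rfl | ⟨e, he⟩
  · exact splitsIntoCurves_zero
  · refine (splitsIntoPath M e.1 e.1 (by rw [h])).splitsIntoCurves ?_
    exact mem_biUnion he (left_mem_segment ℝ _ _)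

end Decomposition

/-! ### Cauchy domains around compact sets -/

section Existence

open Set

/-- A compact subset of an open set `U` is contained in a Cauchy domain in `U`. -/
theorem CauchyDomain.exists_superset {K U : Set ℂ} (hK : IsCompact K) (hU : IsOpen U)
    (hKU : K ⊆ U) : ∃ Δ : CauchyDomain U, K ⊆ Δ.carrier := by
  obtain ⟨δ, S, hδ, hKS, hSU⟩ := exists_grid hK hU hKU
  obtain ⟨L, hLU, hLI⟩ := splitsIntoCurves _ (map_fst_gridEdges δ S)
  have hedge : edgeUnion (gridEdges δ S) = gridUnion δ S \ gridInterior δ S := by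
    ext z
    rw [← exists_mem_segment_gridEdges hδ]
    simp [edgeUnion]
  -- The factor 1 brings the winding integral into the form of Cauchy's formula for a constant
  -- function.
  have hcontour : ∀ z ∉ edgeUnion (gridEdges δ S),
      contourIntegral (fun j => L.get j) (fun ζ => (ζ - z)⁻¹) =
        gridIntegral δ S fun ζ => (ζ - z)⁻¹ • (1 : ℂ) := by
    intro z hz
    have h1 : contourIntegral (fun j => L.get j) (fun ζ => (ζ - z)⁻¹) =
        curveSum L fun ζ => (ζ - z)⁻¹ := by
      rw [contourIntegral_eq_sum, curveSum]
      exact Fin.sum_univ_fun_getElem L fun γ => pathIntegral γ.path fun ζ => (ζ - z)⁻¹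
    rw [h1, hLI]
    · simp [edgeIntegral, gridIntegral]
    · exact continuousOn_inv_sub hz
  refine ⟨{
    carrier := gridInterior δ S
    isOpen := isOpen_gridInterior hδ S
    isBounded := (isCompact_gridUnion δ S).isBounded.subset (gridInterior_subset_gridUnion hδ S)
    closure_subset := by rwa [closure_gridInterior hδ]
    card := L.length
    boundary := fun j => L.get j
    frontier_eq := ?_
    winding_inside := fun z hz => ?_
    winding_outside := fun z hz => ?_ }, hKS⟩
  · rw [(isOpen_gridInterior hδ S).frontier_eq, closure_gridInterior hδ, ← hedge, ← hLU]
    ext z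
    simp [curveUnion, List.mem_iff_get]
  · rw [hcontour z (fun h => (hedge ▸ h).2 hz),
      gridIntegral_inv_sub_smul hδ (differentiableOn_const 1) hz, smul_eq_mul, mul_one,
      inv_mul_cancel₀ Complex.two_pi_I_ne_zero]
  · rw [closure_gridInterior hδ] at hz
    rw [hcontour z (fun h => hz (hedge ▸ h).1), gridIntegral_eq_zero hδ
      (differentiableOn_inv_sub_smul (differentiableOn_const 1) hz), mul_zero]

end Existence

/-! ### Cauchy's theorem for families of closed curves -/

section CauchyTheorem

open Set Complex

variable {E : Type*} [NormedAddCommGroup E] [NormedSpace ℂ E] {a b : ℂ}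

theorem ClosedCurve.smooth (γ : ClosedCurve) : PiecewiseSmooth γ.path := γ.piecewise_smooth

theorem PiecewiseSmooth.integral_multiset_sum {p : Path a b} (hp : PiecewiseSmooth p) {α : Type*}
    (M : Multiset α) {g : α → ℂ → E} (hg : ∀ e ∈ M, ContinuousOn (g e) (range p)) :
    ContinuousOn (fun ζ => (M.map fun e => g e ζ).sum) (range p) ∧
    pathIntegral p (fun ζ => (M.map fun e => g e ζ).sum) =
      (M.map fun e => pathIntegral p (g e)).sum := by
  induction M using Multiset.induction_on with
  | empty => exact ⟨by simpa using continuousOn_const, by simp [pathIntegral_eq]⟩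
  | cons e M ih =>
    have h1 := hg e (Multiset.mem_cons_self e M)
    have h2 := ih fun e' he' => hg e' (Multiset.mem_cons_of_mem he')
    simp only [Multiset.map_cons, Multiset.sum_cons]
    exact ⟨h1.add h2.1, by rw [hp.integral_add h1 h2.1, h2.2]⟩

variable {δ : ℝ} {S : Finset (ℤ × ℤ)}

theorem gridIntegral_congr (hδ : 0 < δ) {f g : ℂ → E}
    (h : EqOn f g (gridUnion δ S \ gridInterior δ S)) :
    gridIntegral δ S f = gridIntegral δ S g := by
  refine congrArg Multiset.sum (Multiset.map_congr rfl fun e he => pathIntegral_congr _ ?_)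
  rw [Path.range_segment]
  exact h.mono (segment_gridEdges_subset hδ he)

theorem gridIntegral_smul (k : ℂ) (f : ℂ → E) :
    gridIntegral δ S (fun w => k • f w) = k • gridIntegral δ S f := by
  simp only [gridIntegral, pathIntegral_smul, Multiset.smul_sum, Multiset.map_map,
    Function.comp_def]

theorem gridIntegral_sum (hδ : 0 < δ) {ι : Type*} (s : Finset ι) {f : ι → ℂ → E}
    (hf : ∀ i ∈ s, ContinuousOn (f i) (gridUnion δ S \ gridInterior δ S)) :
    gridIntegral δ S (fun w => ∑ i ∈ s, f i w) = ∑ i ∈ s, gridIntegral δ S (f i) := by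
  simp only [gridIntegral]
  rw [← Multiset.sum_map_sum]
  refine congrArg Multiset.sum (Multiset.map_congr rfl fun e he => ?_)
  refine (piecewiseSmooth_segment e.1 e.2).integral_sum s fun i hi => ?_
  rw [Path.range_segment]
  exact (hf i hi).mono (segment_gridEdges_subset hδ he)

/-- An integral over a path inside a union of grid squares, expressed through the boundary values
of the function. -/
theorem PiecewiseSmooth.integral_eq_gridIntegral [CompleteSpace E] {p : Path a b}
    (hp : PiecewiseSmooth p) (hδ : 0 < δ) (hpS : range p ⊆ gridInterior δ S) {f : ℂ → E}
    (hf : DifferentiableOn ℂ f (gridUnion δ S)) :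
    (2 * Real.pi * I : ℂ) • pathIntegral p f =
      gridIntegral δ S fun w => pathIntegral p (fun ζ => (w - ζ)⁻¹) • f w := by
  rw [← pathIntegral_smul]
  have hdisj : ∀ e ∈ gridEdges δ S, ∀ w ∈ segment ℝ e.1 e.2, w ∉ range p := fun e he w hw hwp =>
    (segment_gridEdges_subset hδ he hw).2 (hpS hwp)
  have hfe : ∀ e ∈ gridEdges δ S, ContinuousOn f (segment ℝ e.1 e.2) := fun e he =>
    hf.continuousOn.mono ((segment_gridEdges_subset hδ he).trans sdiff_subset)
  have hcont : ∀ e ∈ gridEdges δ S, ContinuousOn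
      (fun ζ => pathIntegral (Path.segment e.1 e.2) fun w => (w - ζ)⁻¹ • f w) (range p) := by
    intro e he
    refine ((piecewiseSmooth_segment e.1 e.2).differentiableOn_cauchy ?_).continuousOn.mono ?_
    · rw [Path.range_segment]
      exact hfe e he
    · rw [Path.range_segment]
      exact fun ζ hζ h => hdisj e he ζ h hζ
  -- Cauchy's formula over the grid boundary replaces f(ζ); Fubini's theorem then lets the kernel be
  -- integrated over `p` first.
  rw [pathIntegral_congr p fun ζ hζ => (gridIntegral_inv_sub_smul hδ hf (hpS hζ)).symm]
  simp only [gridIntegral]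
  rw [(hp.integral_multiset_sum _ hcont).2]
  refine congrArg Multiset.sum (Multiset.map_congr rfl fun e he => ?_)
  rw [hp.integral_swap (piecewiseSmooth_segment e.1 e.2) (K := fun ζ w => (w - ζ)⁻¹ • f w)]
  · simp only [pathIntegral_smul_const]
  · rw [Path.range_segment]
    refine ContinuousOn.smul (ContinuousOn.inv₀ (by fun_prop) ?_)
      ((hfe e he).comp continuousOn_snd fun z hz => hz.2)
    rintro ⟨ζ, w⟩ ⟨hζ, hw⟩ h
    have hwζ : w = ζ := sub_eq_zero.1 h
    exact hdisj e he w hw (hwζ ▸ hζ)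

/-- The sign comes from (w - ζ)⁻¹ = -(ζ - w)⁻¹. The integral of f thus depends on Γ only through its
winding around the points of the grid boundary. -/
theorem contourIntegral_eq_gridIntegral [CompleteSpace E] {k : ℕ} (Γ : Fin k → ClosedCurve)
    (hδ : 0 < δ) (hΓ : ∀ j, range (Γ j).path ⊆ gridInterior δ S) {f : ℂ → E}
    (hf : DifferentiableOn ℂ f (gridUnion δ S)) :
    (2 * Real.pi * I : ℂ) • contourIntegral Γ f =
      -gridIntegral δ S fun w => contourIntegral Γ (fun ζ => (ζ - w)⁻¹) • f w := by
  have hneg : ∀ j w, pathIntegral (Γ j).path (fun ζ => (w - ζ)⁻¹) =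
      (-1 : ℂ) • pathIntegral (Γ j).path fun ζ => (ζ - w)⁻¹ := fun j w => by
    rw [← pathIntegral_smul]
    congr with ζ
    rw [← neg_sub ζ w, inv_neg, neg_one_smul]
  simp only [contourIntegral_eq_sum, Finset.smul_sum, Finset.sum_smul]
  rw [gridIntegral_sum hδ, ← Finset.sum_neg_distrib]
  · refine Finset.sum_congr rfl fun j _ => ?_
    rw [(Γ j).smooth.integral_eq_gridIntegral hδ (hΓ j) hf, ← neg_one_smul ℂ, ← gridIntegral_smul]
    simp only [hneg, smul_assoc]
  · intro j _
    refine ContinuousOn.smul ?_ (hf.continuousOn.mono sdiff_subset)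
    have h := ((Γ j).smooth.differentiableOn_cauchy (φ := fun _ => (1 : ℂ))
      continuousOn_const).continuousOn
    simp only [smul_eq_mul, mul_one] at h
    exact h.mono fun w hw hmem => hw.2 (hΓ j hmem)

/-- Cauchy's theorem: if the winding numbers of two families of closed curves in a compact subset
`L` of an open set `W` are proportional off `L`, then so are the integrals of a function which is
analytic in `W`. -/
theorem contourIntegral_eq_of_winding [CompleteSpace E] {k l : ℕ} (Γ₁ : Fin k → ClosedCurve)
    (Γ₂ : Fin l → ClosedCurve) {L W : Set ℂ} (hL : IsCompact L) (hW : IsOpen W) (hLW : L ⊆ W)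
    (h₁ : ∀ j, range (Γ₁ j).path ⊆ L) (h₂ : ∀ j, range (Γ₂ j).path ⊆ L) (c : ℂ)
    (hc : ∀ w ∉ L, contourIntegral Γ₁ (fun ζ => (ζ - w)⁻¹) =
      c * contourIntegral Γ₂ (fun ζ => (ζ - w)⁻¹))
    {f : ℂ → E} (hf : DifferentiableOn ℂ f W) :
    contourIntegral Γ₁ f = c • contourIntegral Γ₂ f := by
  -- L lies in the grid interior, so the grid boundary avoids L and the winding hypothesis applies
  -- at each of its points.
  obtain ⟨δ, S, hδ, hLS, hSW⟩ := exists_grid hL hW hLW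
  have hf' := hf.mono hSW
  refine (smul_right_injective E two_pi_I_ne_zero) ?_
  beta_reduce
  rw [smul_comm _ c, contourIntegral_eq_gridIntegral Γ₁ hδ (fun j => (h₁ j).trans hLS) hf',
    contourIntegral_eq_gridIntegral Γ₂ hδ (fun j => (h₂ j).trans hLS) hf', smul_neg,
    ← gridIntegral_smul, neg_inj]
  refine gridIntegral_congr hδ fun w hw => ?_
  rw [hc w fun h => hw.2 (hLS h), mul_smul]

end CauchyTheorem

/-! ### The Riesz-Dunford calculus in a complex Banach algebra -/

section Contour

open Set Complex

variable {E : Type*} [NormedAddCommGroup E] [NormedSpace ℂ E] {k : ℕ} {Γ : Fin k → ClosedCurve}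

theorem contourIntegral_congr {f g : ℂ → E} (h : ∀ j, EqOn f g (range (Γ j).path)) :
    contourIntegral Γ f = contourIntegral Γ g := by
  simp only [contourIntegral_eq_sum]
  exact Finset.sum_congr rfl fun j _ => pathIntegral_congr _ (h j)

theorem contourIntegral_add {f g : ℂ → E} (hf : ∀ j, ContinuousOn f (range (Γ j).path))
    (hg : ∀ j, ContinuousOn g (range (Γ j).path)) :
    contourIntegral Γ (fun ζ => f ζ + g ζ) = contourIntegral Γ f + contourIntegral Γ g := by
  simp only [contourIntegral_eq_sum, ← Finset.sum_add_distrib]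
  exact Finset.sum_congr rfl fun j _ => (Γ j).smooth.integral_add (hf j) (hg j)

theorem contourIntegral_sub {f g : ℂ → E} (hf : ∀ j, ContinuousOn f (range (Γ j).path))
    (hg : ∀ j, ContinuousOn g (range (Γ j).path)) :
    contourIntegral Γ (fun ζ => f ζ - g ζ) = contourIntegral Γ f - contourIntegral Γ g := by
  simp only [contourIntegral_eq_sum, ← Finset.sum_sub_distrib]
  exact Finset.sum_congr rfl fun j _ => (Γ j).smooth.integral_sub (hf j) (hg j)

theorem contourIntegral_smul (c : ℂ) (f : ℂ → E) :
    contourIntegral Γ (fun ζ => c • f ζ) = c • contourIntegral Γ f := by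
  simp only [contourIntegral_eq_sum, Finset.smul_sum, pathIntegral_smul]

theorem contourIntegral_smul_const [CompleteSpace E] (f : ℂ → ℂ) (x : E) :
    contourIntegral Γ (fun ζ => f ζ • x) = contourIntegral Γ f • x := by
  simp only [contourIntegral_eq_sum, Finset.sum_smul, pathIntegral_smul_const]

theorem map_contourIntegral [CompleteSpace E] {F : Type*} [NormedAddCommGroup F] [NormedSpace ℂ F]
    [CompleteSpace F] (L : E →L[ℂ] F) {f : ℂ → E} (hf : ∀ j, ContinuousOn f (range (Γ j).path)) :
    L (contourIntegral Γ f) = contourIntegral Γ fun ζ => L (f ζ) := by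
  simp only [contourIntegral_eq_sum, map_sum]
  exact Finset.sum_congr rfl fun j _ => (Γ j).smooth.map_integral L (hf j)

theorem differentiableOn_cauchy_contour [CompleteSpace E] {φ : ℂ → E} {s : Set ℂ}
    (hs : ∀ j, Disjoint s (range (Γ j).path)) (hφ : ∀ j, ContinuousOn φ (range (Γ j).path)) :
    DifferentiableOn ℂ (fun z => contourIntegral Γ fun ζ => (ζ - z)⁻¹ • φ ζ) s := by
  simp only [contourIntegral_eq_sum]
  exact DifferentiableOn.fun_sum fun j _ =>
    ((Γ j).smooth.differentiableOn_cauchy (hφ j)).mono (hs j).subset_compl_right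

end Contour

/-! ### Cauchy's theorem and integral formula on a Cauchy domain -/

namespace CauchyDomain

open Set Complex

variable {E : Type*} [NormedAddCommGroup E] [NormedSpace ℂ E] {U : Set ℂ} (Δ : CauchyDomain U)

theorem range_subset_frontier (j : Fin Δ.card) :
    range (Δ.boundary j).path ⊆ frontier Δ.carrier := by
  rw [Δ.frontier_eq]
  exact subset_iUnion (fun j => range (Δ.boundary j).path) j

theorem range_subset_closure (j : Fin Δ.card) : range (Δ.boundary j).path ⊆ closure Δ.carrier :=
  (Δ.range_subset_frontier j).trans frontier_subset_closure

theorem disjoint_range (j : Fin Δ.card) : Disjoint Δ.carrier (range (Δ.boundary j).path) :=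
  (disjoint_iff_inter_eq_empty.2 Δ.isOpen.inter_frontier_eq).mono_right
    (Δ.range_subset_frontier j)

theorem isCompact_closure : IsCompact (closure Δ.carrier) := Δ.isBounded.isCompact_closure

theorem contourIntegral_inv_sub {z : ℂ} (hz : z ∈ Δ.carrier) :
    contourIntegral Δ.boundary (fun ζ => (ζ - z)⁻¹) = 2 * Real.pi * I := by
  have h := Δ.winding_inside z hz
  rwa [inv_mul_eq_iff_eq_mul₀ two_pi_I_ne_zero, mul_one] at h

theorem contourIntegral_inv_sub_eq_zero {z : ℂ} (hz : z ∉ closure Δ.carrier) :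
    contourIntegral Δ.boundary (fun ζ => (ζ - z)⁻¹) = 0 := by
  have h := Δ.winding_outside z hz
  rwa [inv_mul_eq_iff_eq_mul₀ two_pi_I_ne_zero, mul_zero] at h

/-- Cauchy's theorem for a Cauchy domain. -/
theorem contourIntegral_eq_zero [CompleteSpace E] {O : Set ℂ} (hO : IsOpen O)
    (hΔ : closure Δ.carrier ⊆ O) {f : ℂ → E} (hf : DifferentiableOn ℂ f O) :
    contourIntegral Δ.boundary f = 0 := by
  -- The comparison is with the empty family and the factor 0.
  have h := contourIntegral_eq_of_winding Δ.boundary (Fin.elim0 : Fin 0 → ClosedCurve)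
    Δ.isCompact_closure hO hΔ Δ.range_subset_closure (fun j => j.elim0) 0
    (fun w hw => by rw [Δ.contourIntegral_inv_sub_eq_zero hw, zero_mul]) hf
  rw [h, zero_smul]

/-- Cauchy's integral formula for a Cauchy domain. -/
theorem contourIntegral_inv_sub_smul [CompleteSpace E] {O : Set ℂ} (hO : IsOpen O)
    (hΔ : closure Δ.carrier ⊆ O) {f : ℂ → E} (hf : DifferentiableOn ℂ f O) {z : ℂ}
    (hz : z ∈ Δ.carrier) :
    contourIntegral Δ.boundary (fun w => (w - z)⁻¹ • f w) = (2 * Real.pi * I : ℂ) • f z := by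
  have hzO : O ∈ nhds z := hO.mem_nhds (hΔ (subset_closure hz))
  have hnot : ∀ j, z ∉ range (Δ.boundary j).path := fun j h =>
    disjoint_left.1 (Δ.disjoint_range j) hz h
  have h0 := Δ.contourIntegral_eq_zero hO hΔ ((differentiableOn_dslope hzO).2 hf)
  have hcf : ∀ j, ContinuousOn f (range (Δ.boundary j).path) := fun j =>
    hf.continuousOn.mono ((Δ.range_subset_closure j).trans hΔ)
  have h1 : contourIntegral Δ.boundary (dslope f z) =
      contourIntegral Δ.boundary fun w => (w - z)⁻¹ • f w - (w - z)⁻¹ • f z := by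
    refine contourIntegral_congr fun j w hw => ?_
    have hne : w ≠ z := fun h => hnot j (h ▸ hw)
    rw [dslope_of_ne _ hne, slope_def_module, smul_sub]
  rw [h1, contourIntegral_sub, contourIntegral_smul_const, Δ.contourIntegral_inv_sub hz,
    sub_eq_zero] at h0
  · exact h0
  · exact fun j => (continuousOn_inv_sub (hnot j)).smul (hcf j)
  · exact fun j => (continuousOn_inv_sub (hnot j)).smul continuousOn_const

end CauchyDomain

/-! ### The resolvent: identities and analyticity -/

section Resolvent

variable {A : Type*} [NormedRing A] [NormedAlgebra ℂ A] {t : A} {z w : ℂ}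

theorem resolvent_mul_sub (hz : z ∉ spectrum ℂ t) :
    resolvent t z * (algebraMap ℂ A z - t) = 1 :=
  Ring.inverse_mul_cancel _ (spectrum.notMem_iff.1 hz)

theorem sub_mul_resolvent (hz : z ∉ spectrum ℂ t) :
    (algebraMap ℂ A z - t) * resolvent t z = 1 :=
  Ring.mul_inverse_cancel _ (spectrum.notMem_iff.1 hz)

/-- The first resolvent identity. -/
theorem resolvent_mul_resolvent (hz : z ∉ spectrum ℂ t) (hw : w ∉ spectrum ℂ t) (hne : w ≠ z) :
    resolvent t z * resolvent t w = (w - z)⁻¹ • (resolvent t z - resolvent t w) := by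
  rw [eq_inv_smul_iff₀ (sub_ne_zero.2 hne)]
  calc (w - z) • (resolvent t z * resolvent t w)
      = resolvent t z * ((algebraMap ℂ A w - t) - (algebraMap ℂ A z - t)) * resolvent t w := by
        rw [sub_sub_sub_cancel_right, ← map_sub, ← Algebra.commutes, mul_assoc, Algebra.smul_def]
    _ = _ := by
        rw [mul_sub, sub_mul, mul_assoc, sub_mul_resolvent hw, resolvent_mul_sub hz, mul_one,
          one_mul]

theorem differentiableOn_resolvent [CompleteSpace A] :
    DifferentiableOn ℂ (resolvent t) (spectrum ℂ t)ᶜ := fun _ hz =>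
  (spectrum.hasDerivAt_resolvent_const_left
    (by simpa [spectrum] using hz)).differentiableAt.differentiableWithinAt

theorem isOpen_compl_spectrum [CompleteSpace A] : IsOpen (spectrum ℂ t)ᶜ :=
  (spectrum.isClosed t).isOpen_compl

end Resolvent

/-! ### The Riesz-Dunford integral and its multiplicativity -/

section Dunford

open Set Complex

variable {A : Type*} [NormedRing A] [NormedAlgebra ℂ A] {U : Set ℂ}

/-- The Riesz-Dunford integral `(2πi)⁻¹ ∫_Γ F(ζ) (ζ - t)⁻¹ dζ` in a Banach algebra. -/
def dunford (Δ : CauchyDomain U) (t : A) (F : ℂ → A) : A :=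
  (2 * Real.pi * I : ℂ)⁻¹ • contourIntegral Δ.boundary fun ζ => F ζ * resolvent t ζ

theorem dunford_congr (Δ : CauchyDomain U) (t : A) {F G : ℂ → A} (h : EqOn F G U) :
    dunford Δ t F = dunford Δ t G := by
  rw [dunford, dunford]
  congr 1
  refine contourIntegral_congr fun j ζ hζ => ?_
  rw [h (Δ.closure_subset (Δ.range_subset_closure j hζ))]

theorem dunford_smul (Δ : CauchyDomain U) (t : A) (c : ℂ) (F : ℂ → A) :
    dunford Δ t (fun ζ => c • F ζ) = c • dunford Δ t F := by
  simp only [dunford, smul_mul_assoc]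
  rw [contourIntegral_smul, smul_comm]

variable [CompleteSpace A] {Δ : CauchyDomain U} {t : A}

theorem CauchyDomain.continuousOn_resolvent (ht : spectrum ℂ t ⊆ Δ.carrier) (j : Fin Δ.card) :
    ContinuousOn (resolvent t) (range (Δ.boundary j).path) :=
  differentiableOn_resolvent.continuousOn.mono fun _ hz hσ =>
    disjoint_left.1 (Δ.disjoint_range j) (ht hσ) hz

theorem CauchyDomain.continuousOn_of_differentiableOn {E : Type*} [NormedAddCommGroup E]
    [NormedSpace ℂ E] {F : ℂ → E} (hF : DifferentiableOn ℂ F U) (j : Fin Δ.card) :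
    ContinuousOn F (range (Δ.boundary j).path) :=
  hF.continuousOn.mono ((Δ.range_subset_closure j).trans Δ.closure_subset)

theorem dunford_add (ht : spectrum ℂ t ⊆ Δ.carrier) {F G : ℂ → A} (hF : DifferentiableOn ℂ F U)
    (hG : DifferentiableOn ℂ G U) :
    dunford Δ t (fun ζ => F ζ + G ζ) = dunford Δ t F + dunford Δ t G := by
  simp only [dunford, add_mul]
  rw [contourIntegral_add, smul_add]
  · exact fun j => (Δ.continuousOn_of_differentiableOn hF j).mul (Δ.continuousOn_resolvent ht j)
  · exact fun j => (Δ.continuousOn_of_differentiableOn hG j).mul (Δ.continuousOn_resolvent ht j)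

theorem dunford_const_mul (ht : spectrum ℂ t ⊆ Δ.carrier) (a : A) {F : ℂ → A}
    (hF : DifferentiableOn ℂ F U) : dunford Δ t (fun ζ => a * F ζ) = a * dunford Δ t F := by
  have h := map_contourIntegral (ContinuousLinearMap.mul ℂ A a)
    (f := fun ζ => F ζ * resolvent t ζ) (Γ := Δ.boundary) fun j =>
    (Δ.continuousOn_of_differentiableOn hF j).mul (Δ.continuousOn_resolvent ht j)
  simp only [ContinuousLinearMap.mul_apply'] at h
  simp only [dunford, mul_assoc, mul_smul_comm]
  rw [h]

/-- The function `z ↦ (z - t)⁻¹ (f(z) - f(t))` extends analytically to the spectrum of `t`. -/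
theorem exists_differentiableOn_resolvent_mul (ht : spectrum ℂ t ⊆ Δ.carrier) {O : Set ℂ}
    (hO : IsOpen O) (hΔ : closure Δ.carrier ⊆ O) {f : ℂ → ℂ} (hf : DifferentiableOn ℂ f O) :
    ∃ h : ℂ → A, DifferentiableOn ℂ h O ∧ ∀ z ∈ O \ spectrum ℂ t,
      h z = resolvent t z * (f z • 1 - dunford Δ t fun ζ => f ζ • 1) := by
  classical
  set a := dunford Δ t fun ζ => f ζ • (1 : A) with ha
  -- This Cauchy integral makes sense on the whole of Δ, including the spectrum.
  set C : ℂ → A := fun z => (2 * Real.pi * I : ℂ)⁻¹ •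
    contourIntegral Δ.boundary fun w => (w - z)⁻¹ • (f w • resolvent t w) with hC
  have hfR : ∀ j, ContinuousOn (fun w => f w • resolvent t w) (range (Δ.boundary j).path) :=
    fun j => (hf.continuousOn.mono ((Δ.range_subset_closure j).trans hΔ)).smul
      (Δ.continuousOn_resolvent ht j)
  have hCd : DifferentiableOn ℂ C Δ.carrier :=
    (differentiableOn_cauchy_contour Δ.disjoint_range hfR).fun_const_smul _
  -- By the resolvent identity, 2πi (z - t)⁻¹ a is the integral of f(w) (w - z)⁻¹ ((z - t)⁻¹ - (w -
  -- t)⁻¹). Cauchy's formula evaluates the first part; the second is 2πi C(z).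
  have key : ∀ z ∈ Δ.carrier \ spectrum ℂ t, C z = resolvent t z * (f z • 1 - a) := by
    rintro z ⟨hz, hzt⟩
    have hnot : ∀ j, z ∉ range (Δ.boundary j).path := fun j h =>
      disjoint_left.1 (Δ.disjoint_range j) hz h
    have h1 := map_contourIntegral (ContinuousLinearMap.mul ℂ A (resolvent t z)) hfR
    simp only [ContinuousLinearMap.mul_apply'] at h1
    have h2 : (contourIntegral Δ.boundary fun w => resolvent t z * (f w • resolvent t w)) =
        contourIntegral Δ.boundary fun w => ((w - z)⁻¹ * f w) • resolvent t z -
          (w - z)⁻¹ • (f w • resolvent t w) := by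
      refine contourIntegral_congr fun j w hw => ?_
      rw [mul_smul_comm, resolvent_mul_resolvent hzt
        (fun h => disjoint_left.1 (Δ.disjoint_range j) (ht h) hw) (fun h => hnot j (h ▸ hw))]
      module
    have h3 := Δ.contourIntegral_inv_sub_smul hO hΔ hf hz
    simp only [smul_eq_mul] at h3
    rw [h2, contourIntegral_sub, contourIntegral_smul_const, h3] at h1
    · rw [hC, ha, dunford, mul_sub, mul_smul_comm, mul_one]
      simp only [smul_mul_assoc, one_mul, mul_smul_comm]
      rw [h1, smul_sub, smul_smul, inv_mul_cancel_left₀ two_pi_I_ne_zero, sub_sub_cancel]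
    · exact fun j => ((continuousOn_inv_sub (hnot j)).mul
        (hf.continuousOn.mono ((Δ.range_subset_closure j).trans hΔ))).smul continuousOn_const
    · exact fun j => (continuousOn_inv_sub (hnot j)).smul (hfR j)
  -- Both expressions agree on Δ off the spectrum, so the glued function is differentiable near
  -- every point.
  refine ⟨fun z => if z ∈ Δ.carrier then C z else resolvent t z * (f z • 1 - a), ?_, ?_⟩
  · intro z hz
    refine DifferentiableAt.differentiableWithinAt ?_
    by_cases hzt : z ∈ spectrum ℂ t
    · refine (hCd.differentiableAt (Δ.isOpen.mem_nhds (ht hzt))).congr_of_eventuallyEq ?_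
      filter_upwards [Δ.isOpen.mem_nhds (ht hzt)] with w hw using if_pos hw
    · have hd : DifferentiableAt ℂ (fun z => resolvent t z * (f z • 1 - a)) z :=
        (differentiableOn_resolvent.differentiableAt (isOpen_compl_spectrum.mem_nhds hzt)).mul
          (((hf.differentiableAt (hO.mem_nhds hz)).smul_const 1).sub_const a)
      refine hd.congr_of_eventuallyEq ?_
      filter_upwards [isOpen_compl_spectrum.mem_nhds hzt] with w hw
      split_ifs with h
      · exact key w ⟨h, hw⟩
      · rfl
  · rintro z ⟨-, hzt⟩
    dsimp only
    split_ifs with h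
    · exact key z ⟨h, hzt⟩
    · rfl

/-- Let e be the integral. For f = 1 the extension is entire and equals (z - t)⁻¹ (1 - e) off the
spectrum. It tends to 0 at infinity, so it vanishes by Liouville's theorem, and e = 1. -/
theorem dunford_one (ht : spectrum ℂ t ⊆ Δ.carrier) : dunford Δ t (fun _ => 1) = 1 := by
  obtain ⟨h, hd, hh⟩ := exists_differentiableOn_resolvent_mul ht isOpen_univ (subset_univ _)
    (differentiableOn_const (1 : ℂ))
  simp only [one_smul] at hh
  have hlim : Filter.Tendsto h (Filter.cocompact ℂ) (nhds 0) := by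
    have h1 := (spectrum.resolvent_tendsto_cobounded (𝕜 := ℂ) t).mul_const
      (1 - dunford Δ t fun _ => 1)
    rw [zero_mul, Metric.cobounded_eq_cocompact] at h1
    refine h1.congr' ?_
    filter_upwards [(spectrum.isCompact (𝕜 := ℂ) t).compl_mem_cocompact] with z hz
    exact (hh z ⟨mem_univ z, hz⟩).symm
  obtain ⟨z, hz⟩ := (ne_univ_iff_exists_notMem _).1 (spectrum.isCompact (𝕜 := ℂ) t).ne_univ
  have h0 := hh z ⟨mem_univ z, hz⟩
  rw [(differentiableOn_univ.1 hd).apply_eq_of_tendsto_cocompact z hlim] at h0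
  have h1 := congrArg ((algebraMap ℂ A z - t) * ·) h0
  simp only [← mul_assoc, sub_mul_resolvent hz, one_mul, mul_zero] at h1
  exact (sub_eq_zero.1 h1.symm).symm

/-- The Riesz-Dunford calculus is multiplicative for a scalar factor. -/
theorem dunford_smul_eq_mul (hU : IsOpen U) (ht : spectrum ℂ t ⊆ Δ.carrier) {F : ℂ → A}
    {f : ℂ → ℂ} (hF : DifferentiableOn ℂ F U) (hf : DifferentiableOn ℂ f U) :
    dunford Δ t (fun ζ => f ζ • F ζ) = dunford Δ t F * dunford Δ t fun ζ => f ζ • 1 := by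
  obtain ⟨h, hd, hh⟩ := exists_differentiableOn_resolvent_mul ht hU Δ.closure_subset hf
  -- The product F h is analytic on all of U and equals F(ζ) (ζ - t)⁻¹ (f(ζ) - f(t)) on the
  -- boundary; the vanishing of its integral is the claim.
  have h0 := Δ.contourIntegral_eq_zero hU Δ.closure_subset (hF.mul hd)
  have hcF := fun j => Δ.continuousOn_of_differentiableOn hF j
  have hcf := fun j => Δ.continuousOn_of_differentiableOn hf j
  have hcR := fun j => Δ.continuousOn_resolvent ht j
  set a := dunford Δ t fun ζ => f ζ • (1 : A)
  have h1 : contourIntegral Δ.boundary (fun ζ => F ζ * h ζ) =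
      contourIntegral Δ.boundary fun ζ => f ζ • F ζ * resolvent t ζ -
        F ζ * resolvent t ζ * a := by
    refine contourIntegral_congr fun j w hw => ?_
    rw [hh w ⟨Δ.closure_subset (Δ.range_subset_closure j hw),
      fun h => disjoint_left.1 (Δ.disjoint_range j) (ht h) hw⟩, mul_sub, mul_smul_comm, mul_one,
      mul_sub, mul_smul_comm, smul_mul_assoc, mul_assoc]
  have h2 := map_contourIntegral ((ContinuousLinearMap.mul ℂ A).flip a)
    (f := fun ζ => F ζ * resolvent t ζ) (Γ := Δ.boundary) fun j => (hcF j).mul (hcR j)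
  simp only [ContinuousLinearMap.flip_apply, ContinuousLinearMap.mul_apply'] at h2
  have h3 : contourIntegral Δ.boundary (fun ζ => F ζ * h ζ) = 0 := h0
  rw [h1, contourIntegral_sub, ← h2, sub_eq_zero] at h3
  · rw [dunford, h3, dunford, smul_mul_assoc]
  · exact fun j => ((hcf j).smul (hcF j)).mul (hcR j)
  · exact fun j => ((hcF j).mul (hcR j)).mul continuousOn_const

/-- Since ζ (ζ - t)⁻¹ = 1 + t (ζ - t)⁻¹, Cauchy's theorem removes the first term and `dunford_one`
evaluates the second. -/
theorem dunford_id (hU : IsOpen U) (ht : spectrum ℂ t ⊆ Δ.carrier) :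
    dunford Δ t (fun ζ => ζ • 1) = t := by
  have h0 := Δ.contourIntegral_eq_zero hU Δ.closure_subset (differentiableOn_const (1 : A))
  have h1 : contourIntegral Δ.boundary (fun ζ => ζ • (1 : A) * resolvent t ζ) =
      contourIntegral Δ.boundary fun ζ => 1 + t * resolvent t ζ := by
    refine contourIntegral_congr fun j w hw => ?_
    have h := sub_mul_resolvent (t := t) (z := w)
      fun h => disjoint_left.1 (Δ.disjoint_range j) (ht h) hw
    rw [sub_mul, sub_eq_iff_eq_add, Algebra.algebraMap_eq_smul_one] at h
    exact h
  have h2 := dunford_const_mul ht t (differentiableOn_const (1 : A))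
  rw [dunford_one ht, mul_one] at h2
  simp only [dunford] at h2
  rw [dunford, h1, contourIntegral_add, h0, zero_add, h2]
  · exact fun j => continuousOn_const
  · exact fun j => continuousOn_const.mul (Δ.continuousOn_resolvent ht j)

theorem dunford_pow (hU : IsOpen U) (ht : spectrum ℂ t ⊆ Δ.carrier) (n : ℕ) :
    dunford Δ t (fun ζ => ζ ^ n • 1) = t ^ n := by
  induction n with
  | zero => simpa using dunford_one ht
  | succ n ih =>
    have h := dunford_smul_eq_mul hU ht (F := fun ζ => ζ ^ n • 1) (f := fun ζ => ζ)
      (by fun_prop) (by fun_prop)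
    rw [ih, dunford_id hU ht] at h
    simp only [smul_smul, ← pow_succ'] at h
    rw [h, pow_succ]

/-- The coefficient stands to the left of the resolvent, so it comes out on the left and need not
commute with t. -/
theorem dunford_pow_smul (hU : IsOpen U) (ht : spectrum ℂ t ⊆ Δ.carrier) (n : ℕ) (a : A) :
    dunford Δ t (fun ζ => ζ ^ n • a) = a * t ^ n := by
  have h := dunford_const_mul ht a (F := fun ζ => ζ ^ n • (1 : A)) (by fun_prop)
  rw [dunford_pow hU ht] at h
  simpa using h

theorem dunford_sum (ht : spectrum ℂ t ⊆ Δ.carrier) {ι : Type*} (s : Finset ι) {F : ι → ℂ → A}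
    (hF : ∀ i ∈ s, DifferentiableOn ℂ (F i) U) :
    dunford Δ t (fun ζ => ∑ i ∈ s, F i ζ) = ∑ i ∈ s, dunford Δ t (F i) := by
  classical
  induction s using Finset.induction_on with
  | empty => simp [dunford, contourIntegral_eq_sum, pathIntegral_eq]
  | insert i s hi ih =>
    simp only [Finset.sum_insert hi]
    rw [dunford_add ht (hF i (Finset.mem_insert_self i s))
      (DifferentiableOn.fun_sum fun j hj => hF j (Finset.mem_insert_of_mem hj)),
      ih fun j hj => hF j (Finset.mem_insert_of_mem hj)]

end Dunford

/-! ### Independence of the Cauchy domain and conjugation -/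

section Conjugation

open Set Complex MeasureTheory

variable {E F : Type*} [NormedAddCommGroup E] [NormedSpace ℂ E] [NormedAddCommGroup F]
  [NormedSpace ℂ F] {a b : ℂ}

theorem Path.extend_map_conj (p : Path a b) (t : ℝ) :
    (p.map continuous_conj).extend t = conj (p.extend t) := rfl

theorem PiecewiseSmooth.map_conj {p : Path a b} (hp : PiecewiseSmooth p) :
    PiecewiseSmooth (p.map continuous_conj) := by
  obtain ⟨n, t, ht, h0, h1, hs⟩ := hp
  exact ⟨n, t, ht, h0, h1, fun i hi => conjCLE.contDiff.comp_contDiffOn (hs i hi)⟩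

/-- A bounded conjugate-linear operator turns an integral into an integral over the conjugate
path. -/
theorem PiecewiseSmooth.map_integral_conj [CompleteSpace E] [CompleteSpace F] (L : E →L[ℝ] F)
    (hL : ∀ (c : ℂ) (x : E), L (c • x) = conj c • L x) {p : Path a b} (hp : PiecewiseSmooth p)
    {f : ℂ → E} (hf : ContinuousOn f (range p)) :
    L (pathIntegral p f) = pathIntegral (p.map continuous_conj) fun ζ => L (f (conj ζ)) := by
  rw [pathIntegral_eq, ← L.intervalIntegral_comp_comm (hp.intervalIntegrable hf), pathIntegral_eq]
  refine intervalIntegral.integral_congr fun t ht => ?_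
  rw [uIcc_of_le zero_le_one] at ht
  have h : derivWithin (p.map continuous_conj).extend (Icc 0 1) t =
      conj (derivWithin p.extend (Icc 0 1) t) := by
    have h1 := conjCLE.comp_fderivWithin (f := p.extend) (uniqueDiffOn_Icc zero_lt_one t ht)
    exact congrArg (fun l : ℝ →L[ℝ] ℂ => l 1) h1
  rw [hL, h, Path.extend_map_conj, conj_conj]

/-- The conjugate of a closed curve. -/
def ClosedCurve.conj (γ : ClosedCurve) : ClosedCurve :=
  ⟨_, γ.path.map continuous_conj, γ.smooth.map_conj⟩

theorem ClosedCurve.range_conj (γ : ClosedCurve) :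
    range γ.conj.path = (fun z : ℂ => starRingEnd ℂ z) ⁻¹' range γ.path := by
  ext z
  constructor
  · rintro ⟨t, rfl⟩
    exact ⟨t, (conj_conj _).symm⟩
  · rintro ⟨t, ht⟩
    exact ⟨t, (congrArg (starRingEnd ℂ) ht).trans (conj_conj z)⟩

theorem map_contourIntegral_conj [CompleteSpace E] [CompleteSpace F] (L : E →L[ℝ] F)
    (hL : ∀ (c : ℂ) (x : E), L (c • x) = conj c • L x) {k : ℕ} {Γ : Fin k → ClosedCurve}
    {f : ℂ → E} (hf : ∀ j, ContinuousOn f (range (Γ j).path)) :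
    L (contourIntegral Γ f) = contourIntegral (fun j => (Γ j).conj) fun ζ => L (f (conj ζ)) := by
  simp only [contourIntegral_eq_sum, map_sum]
  exact Finset.sum_congr rfl fun j _ => (Γ j).smooth.map_integral_conj L hL (hf j)

/-- Two families of curves with proportional winding numbers give proportional integrals of a
function which is analytic off a set around which both wind. -/
theorem contourIntegral_eq_smul [CompleteSpace E] {k l : ℕ} {Γ₁ : Fin k → ClosedCurve}
    {Γ₂ : Fin l → ClosedCurve} {U K C₁ C₂ D₁ D₂ : Set ℂ} (hU : IsOpen U) (hK : IsClosed K)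
    (hC₁ : IsCompact C₁) (hC₂ : IsCompact C₂) (hC₁U : C₁ ⊆ U) (hC₂U : C₂ ⊆ U) (hD₁ : IsOpen D₁)
    (hD₂ : IsOpen D₂) (hK₁ : K ⊆ D₁) (hK₂ : K ⊆ D₂) (h₁ : ∀ j, range (Γ₁ j).path ⊆ C₁ \ D₁)
    (h₂ : ∀ j, range (Γ₂ j).path ⊆ C₂ \ D₂) (c w : ℂ)
    (hw₁ : ∀ z ∈ D₁, contourIntegral Γ₁ (fun ζ => (ζ - z)⁻¹) = c * w)
    (hw₂ : ∀ z ∈ D₂, contourIntegral Γ₂ (fun ζ => (ζ - z)⁻¹) = w)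
    (h0₁ : ∀ z ∉ C₁, contourIntegral Γ₁ (fun ζ => (ζ - z)⁻¹) = 0)
    (h0₂ : ∀ z ∉ C₂, contourIntegral Γ₂ (fun ζ => (ζ - z)⁻¹) = 0)
    {f : ℂ → E} (hf : DifferentiableOn ℂ f (U \ K)) :
    contourIntegral Γ₁ f = c • contourIntegral Γ₂ f := by
  -- This compact set contains both families and avoids K. A point off it lies in D₁ ∩ D₂, where
  -- both windings are prescribed, or outside C₁ ∪ C₂, where both vanish.
  refine contourIntegral_eq_of_winding Γ₁ Γ₂ (L := (C₁ ∪ C₂) \ (D₁ ∩ D₂))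
    ((hC₁.union hC₂).diff (hD₁.inter hD₂)) (hU.sdiff hK) ?_ ?_ ?_ c ?_ hf
  · exact fun z hz => ⟨union_subset hC₁U hC₂U hz.1, fun h => hz.2 ⟨hK₁ h, hK₂ h⟩⟩
  · exact fun j z hz => ⟨Or.inl (h₁ j hz).1, fun h => (h₁ j hz).2 h.1⟩
  · exact fun j z hz => ⟨Or.inr (h₂ j hz).1, fun h => (h₂ j hz).2 h.2⟩
  · intro z hz
    by_cases hD : z ∈ D₁ ∩ D₂
    · rw [hw₁ z hD.1, hw₂ z hD.2]
    · have hC : z ∉ C₁ ∪ C₂ := fun h => hz ⟨h, hD⟩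
      rw [h0₁ z fun h => hC (Or.inl h), h0₂ z fun h => hC (Or.inr h), mul_zero]

theorem CauchyDomain.range_subset {U : Set ℂ} (Δ : CauchyDomain U) (j : Fin Δ.card) :
    range (Δ.boundary j).path ⊆ closure Δ.carrier \ Δ.carrier := by
  rw [← Δ.isOpen.frontier_eq]
  exact Δ.range_subset_frontier j

variable {A : Type*} [NormedRing A] [NormedAlgebra ℂ A] [CompleteSpace A] {U : Set ℂ} {t : A}

theorem differentiableOn_mul_resolvent {G : ℂ → A} (hG : DifferentiableOn ℂ G U) :
    DifferentiableOn ℂ (fun ζ => G ζ * resolvent t ζ) (U \ spectrum ℂ t) :=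
  (hG.mono sdiff_subset).mul (differentiableOn_resolvent.mono fun _ hz => hz.2)

/-- The Riesz-Dunford integral does not depend on the Cauchy domain. -/
theorem dunford_eq_dunford (hU : IsOpen U) {Δ₁ Δ₂ : CauchyDomain U}
    (h₁ : spectrum ℂ t ⊆ Δ₁.carrier) (h₂ : spectrum ℂ t ⊆ Δ₂.carrier) {G : ℂ → A}
    (hG : DifferentiableOn ℂ G U) : dunford Δ₁ t G = dunford Δ₂ t G := by
  rw [dunford, dunford, contourIntegral_eq_smul hU (spectrum.isClosed t) Δ₁.isCompact_closure
    Δ₂.isCompact_closure Δ₁.closure_subset Δ₂.closure_subset Δ₁.isOpen Δ₂.isOpen h₁ h₂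
    Δ₁.range_subset Δ₂.range_subset 1 (2 * Real.pi * I)
    (fun z hz => by rw [Δ₁.contourIntegral_inv_sub hz, one_mul])
    (fun z hz => Δ₂.contourIntegral_inv_sub hz) (fun z hz => Δ₁.contourIntegral_inv_sub_eq_zero hz)
    (fun z hz => Δ₂.contourIntegral_inv_sub_eq_zero hz) (differentiableOn_mul_resolvent hG),
    one_smul]

/-- The Riesz-Dunford integral commutes with a conjugation of the algebra. -/
theorem map_dunford_of_conj (hU : IsOpen U) (hUc : ConjSymmetric U) {Δ : CauchyDomain U}
    (ht : spectrum ℂ t ⊆ Δ.carrier) (htc : ConjSymmetric (spectrum ℂ t)) (L : A →L[ℝ] A)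
    (hL : ∀ (c : ℂ) (x : A), L (c • x) = conj c • L x) {G : ℂ → A}
    (hG : DifferentiableOn ℂ G U) (hLG : ∀ ζ ∈ U \ spectrum ℂ t,
      L (G (conj ζ) * resolvent t (conj ζ)) = G ζ * resolvent t ζ) :
    L (dunford Δ t G) = dunford Δ t G := by
  have hcont : ∀ j, ContinuousOn (fun ζ => G ζ * resolvent t ζ) (range (Δ.boundary j).path) :=
    fun j => (differentiableOn_mul_resolvent hG).continuousOn.mono fun z hz =>
      ⟨Δ.closure_subset (Δ.range_subset_closure j hz), fun h => (Δ.range_subset j hz).2 (ht h)⟩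
  have hrange : ∀ j, range (Δ.boundary j).conj.path ⊆
      ((fun z : ℂ => conj z) ⁻¹' closure Δ.carrier) \ ((fun z : ℂ => conj z) ⁻¹' Δ.carrier) :=
    fun j z hz => by
      rw [ClosedCurve.range_conj] at hz
      exact Δ.range_subset j hz
  -- Inside the domain the winding integral is the imaginary number 2πi, so its conjugate has the
  -- opposite sign.
  have hwind : ∀ z, (∀ j, conj z ∉ range (Δ.boundary j).path) →
      contourIntegral (fun j => (Δ.boundary j).conj) (fun ζ => (ζ - z)⁻¹) =
        conj (contourIntegral Δ.boundary fun ζ => (ζ - conj z)⁻¹) := fun z hz => by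
    have h := map_contourIntegral_conj (conjCLE : ℂ →L[ℝ] ℂ) (fun c x => by simp)
      (fun j => continuousOn_inv_sub (hz j))
    simpa using h.symm
  -- The conjugate curves bound the mirror image of Δ with reversed orientation, hence the factor
  -- -1.
  have h := contourIntegral_eq_smul (Γ₁ := fun j => (Δ.boundary j).conj) (Γ₂ := Δ.boundary)
    (C₁ := (fun z : ℂ => conj z) ⁻¹' closure Δ.carrier)
    (D₁ := (fun z : ℂ => conj z) ⁻¹' Δ.carrier) hU (spectrum.isClosed t)
    (conjCLE.toHomeomorph.isCompact_preimage.2 Δ.isCompact_closure) Δ.isCompact_closure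
    (fun z hz => (hUc z).2 (Δ.closure_subset hz)) Δ.closure_subset
    (Δ.isOpen.preimage continuous_conj) Δ.isOpen (fun z hz => ht ((htc z).1 hz)) ht hrange
    Δ.range_subset (-1) (2 * Real.pi * I) (fun z hz => ?_)
    (fun z hz => Δ.contourIntegral_inv_sub hz) (fun z hz => ?_)
    (fun z hz => Δ.contourIntegral_inv_sub_eq_zero hz) (differentiableOn_mul_resolvent hG)
  · have h1 := map_contourIntegral_conj L hL hcont
    have h2 : (contourIntegral (fun j => (Δ.boundary j).conj) fun ζ =>
        L (G (conj ζ) * resolvent t (conj ζ))) =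
        contourIntegral (fun j => (Δ.boundary j).conj) fun ζ => G ζ * resolvent t ζ := by
      refine contourIntegral_congr fun j z hz => hLG z ⟨?_, fun h => ?_⟩
      · exact (hUc z).2 (Δ.closure_subset (hrange j hz).1)
      · exact (hrange j hz).2 (ht ((htc z).1 h))
    -- The factor -1 cancels the sign from conjugating (2πi)⁻¹.
    rw [dunford, hL, h1, h2, h, smul_smul]
    congr 1
    simp [mul_comm, conj_ofNat]
  · rw [hwind z fun j h => (Δ.range_subset j h).2 hz, Δ.contourIntegral_inv_sub hz]
    simp [conj_ofNat]
  · rw [hwind z fun j h => hz (Δ.range_subset_closure j h), Δ.contourIntegral_inv_sub_eq_zero hz,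
      map_zero]

end Conjugation

/-! ### Real operators on the complexification -/

namespace Complexified

open Complex

variable {V : Type*} [NormedAddCommGroup V] [NormedSpace ℝ V]

theorem real_smul_re (r : ℝ) (w : Complexified V) : (r • w).re = r • w.re := by
  simp [← Complex.coe_smul]

theorem real_smul_im (r : ℝ) (w : Complexified V) : (r • w).im = r • w.im := by
  simp [← Complex.coe_smul]

/-- The embedding of `V` into its complexification. -/
def ofRealL : V →L[ℝ] Complexified V :=
  LinearMap.mkContinuous
    { toFun := fun x => ⟨x, 0⟩
      map_add' := fun x y => by ext <;> simp
      map_smul' := fun r x => by ext <;> simp [real_smul_re, real_smul_im] }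
    1 fun x => (norm_le _).trans (by simp)

/-- The real part, as a bounded linear map. -/
def reL : Complexified V →L[ℝ] V :=
  LinearMap.mkContinuous
    { toFun := re
      map_add' := fun x y => by simp
      map_smul' := fun r x => by simp [real_smul_re] }
    1 fun x => by simpa using norm_re_le x

theorem eq_ofRealL_add (w : Complexified V) : w = ofRealL w.re + I • ofRealL w.im := by
  ext <;> simp [ofRealL]

/-- The real operator `x ↦ Re (S x)`. -/
def realPart : (Complexified V →L[ℂ] Complexified V) →ₗ[ℝ] (V →L[ℝ] V) where
  toFun S := reL ∘L S.restrictScalars ℝ ∘L ofRealL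
  map_add' S S' := by ext x; simp
  map_smul' r S := by ext x; simp

@[simp] theorem realPart_extend (T : V →L[ℝ] V) : realPart (extend T) = T := rfl

theorem extend_injective : Function.Injective (extend (V := V)) :=
  Function.LeftInverse.injective realPart_extend

/-- The operators fixed by the conjugation are the real ones. -/
theorem extend_realPart {S : Complexified V →L[ℂ] Complexified V} (hS : flat S = S) :
    extend (realPart S) = S := by
  have him : ∀ x, S (ofRealL x) = ofRealL (realPart S x) := fun x => by
    have h1 : conjL (S (conjL (ofRealL x))) = S (ofRealL x) := by
      rw [← flat_apply, hS]
    have h2 : conjL (ofRealL x) = ofRealL x := by ext <;> simp [ofRealL]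
    rw [h2] at h1
    ext
    · rfl
    · have h3 := congrArg im h1
      rw [conjL_im] at h3
      -- The imaginary part equals its own negative.
      have h4 : (2 : ℝ) • (S (ofRealL x)).im = 0 := by
        rw [two_smul]
        nth_rewrite 1 [← h3]
        exact neg_add_cancel _
      exact (smul_eq_zero.1 h4).resolve_left two_ne_zero
  ext1 w
  conv_rhs => rw [eq_ofRealL_add w, map_add, map_smul, him, him]
  ext <;> simp [ofRealL]

/-- `extend` as a homomorphism of real algebras. -/
def extendHom : (V →L[ℝ] V) →ₐ[ℝ] (Complexified V →L[ℂ] Complexified V) where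
  toFun := extend
  map_one' := rfl
  map_mul' _ _ := rfl
  map_zero' := rfl
  map_add' _ _ := rfl
  commutes' r := by
    ext1 w
    ext
    · exact (real_smul_re r w).symm
    · exact (real_smul_im r w).symm

/-- By uniqueness of inverses, an inverse of a real operator is fixed by the conjugation, so it is
itself real. -/
theorem isUnit_extend_iff {Q : V →L[ℝ] V} : IsUnit (extend Q) ↔ IsUnit Q := by
  refine ⟨fun h => ?_, fun h => h.map extendHom⟩
  obtain ⟨⟨q, r, hqr, hrq⟩, rfl : q = extend Q⟩ := h
  have hr : flat r = r := by
    refine left_inv_eq_right_inv (a := extend Q) ?_ hqr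
    rw [← flat_extend, ← map_mul, hrq, map_one]
  rw [← extend_realPart hr] at hqr hrq
  exact ⟨⟨Q, realPart r, extend_injective hqr, extend_injective hrq⟩, rfl⟩

theorem flat_flat (S : Complexified V →L[ℂ] Complexified V) : flat (flat S) = S := by
  ext1 w
  simp [flat_apply, conjL_conjL]

theorem flat_algebraMap_sub (T : V →L[ℝ] V) (z : ℂ) :
    flat (algebraMap ℂ _ z - extend T) = algebraMap ℂ _ (conj z) - extend T := by
  rw [map_sub, flat_extend, Algebra.algebraMap_eq_smul_one, flat_smul, map_one,
    Algebra.algebraMap_eq_smul_one]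

theorem isUnit_flat_iff {S : Complexified V →L[ℂ] Complexified V} :
    IsUnit (flat S) ↔ IsUnit S :=
  ⟨fun h => by simpa [flat_flat] using h.map flat, fun h => h.map flat⟩

/-- For z = u + iv the factors are (u - T) ± iv, and the cross terms cancel. This factors the
quadratic expression in `complexSpectrum`. -/
theorem sub_mul_sub_conj (T : V →L[ℝ] V) (z : ℂ) :
    (algebraMap ℂ _ z - extend T) * (algebraMap ℂ _ (conj z) - extend T) =
      extend ((z.re • (1 : V →L[ℝ] V) - T) ^ 2 + (z.im ^ 2) • (1 : V →L[ℝ] V)) := by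
  ext1 w
  ext
  · simp [Algebra.algebraMap_eq_smul_one, pow_two]
    module
  · simp [Algebra.algebraMap_eq_smul_one, pow_two]
    module

/-- The factors z - T and conj z - T commute and are conjugate to each other, so their product is
invertible exactly when one of them is. -/
theorem complexSpectrum_eq (T : V →L[ℝ] V) : complexSpectrum T = spectrum ℂ (extend T) := by
  ext z
  rw [complexSpectrum, Set.mem_ofPred_eq, spectrum.mem_iff, not_iff_not, ← isUnit_extend_iff,
    ← sub_mul_sub_conj, Commute.isUnit_mul_iff, ← flat_algebraMap_sub, isUnit_flat_iff, and_self]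
  exact (Algebra.commute_algebraMap_left z _).sub_left
    ((Algebra.commute_algebraMap_right _ _).sub_right rfl)

theorem conjSymmetric_complexSpectrum (T : V →L[ℝ] V) : ConjSymmetric (complexSpectrum T) :=
  fun z => by simp [complexSpectrum]

/-- The conjugation of `B(V_ℂ)` as a bounded real-linear map. -/
def flatL : (Complexified V →L[ℂ] Complexified V) →L[ℝ] (Complexified V →L[ℂ] Complexified V) :=
  LinearMap.mkContinuous (flat (V := V)).toLinearMap (‖conjL (V := V)‖ * ‖conjL (V := V)‖)
    fun S => by
      refine ContinuousLinearMap.opNorm_le_bound _ (by positivity) fun w => ?_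
      calc ‖conjL (S (conjL w))‖ ≤ ‖conjL (V := V)‖ * (‖S‖ * (‖conjL (V := V)‖ * ‖w‖)) := by
            refine (conjL.le_opNorm _).trans ?_
            gcongr
            refine (S.le_opNorm _).trans ?_
            gcongr
            exact conjL.le_opNorm w
        _ = _ := by ring

theorem flat_resolvent {T : V →L[ℝ] V} {z : ℂ} (hz : z ∉ spectrum ℂ (extend T)) :
    flat (resolvent (extend T) (conj z)) = resolvent (extend T) z := by
  have hz' : conj z ∉ spectrum ℂ (extend T) := by
    rw [← complexSpectrum_eq] at hz ⊢
    rwa [← conjSymmetric_complexSpectrum]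
  refine left_inv_eq_right_inv (a := algebraMap ℂ _ z - extend T) ?_ (sub_mul_resolvent hz)
  have h := congrArg flat (resolvent_mul_sub hz')
  rwa [map_mul, flat_algebraMap_sub, Complex.conj_conj, map_one] at h

end Complexified

/-! ### The functional calculus of a real operator -/

section Stem

open Complexified

variable {U : Set ℂ} {V : Type*} [NormedAddCommGroup V] [NormedSpace ℝ V]

theorem rieszDunford_eq_dunford (Δ : CauchyDomain U) (T : V →L[ℝ] V) (F : OperatorStem U V) :
    rieszDunford Δ T F = dunford Δ (extend T) (extendZero F.1) := rfl

theorem flat_extendZero (hUc : ConjSymmetric U) (F : OperatorStem U V) {ζ : ℂ} (hζ : ζ ∈ U) :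
    flat (extendZero F.1 (conj ζ)) = extendZero F.1 ζ := by
  have hζ' : conj ζ ∈ U := (hUc ζ).1 hζ
  rw [extendZero_of_mem _ hζ, extendZero_of_mem _ hζ',
    F.2.2 ⟨conj ζ, hζ'⟩ ⟨ζ, hζ⟩ (Complex.conj_conj ζ).symm]

theorem ScalarStem.toOperator_mul (f g : ScalarStem U) :
    (f * g).toOperator (V := V) = (f.toOperator).mulScalar g := by
  refine Subtype.ext (funext fun ζ => ?_)
  change (f.1 ζ * g.1 ζ) • (1 : Complexified V →L[ℂ] Complexified V) = g.1 ζ • f.1 ζ • 1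
  rw [smul_smul, mul_comm]

theorem ScalarStem.toOperator_add (f g : ScalarStem U) :
    (f + g).toOperator (V := V) = f.toOperator + g.toOperator :=
  Subtype.ext (funext fun ζ => add_smul (f.1 ζ) (g.1 ζ) _)

theorem ScalarStem.toOperator_algebraMap (r : ℝ) :
    (algebraMap ℝ (ScalarStem U) r).toOperator (V := V) = algebraMap ℝ (OperatorStem U V) r := by
  refine Subtype.ext (funext fun ζ => ?_)
  ext1 w
  rfl

theorem rieszDunford_smul (Δ : CauchyDomain U) (T : V →L[ℝ] V) (r : ℝ) (F : OperatorStem U V) :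
    rieszDunford Δ T (r • F) = r • rieszDunford Δ T F := by
  simp only [rieszDunford_eq_dunford]
  rw [← Complex.coe_smul, ← dunford_smul]
  exact dunford_congr _ _ fun ζ hζ => by
    simp [extendZero_of_mem _ hζ]

variable [CompleteSpace V] {Δ : CauchyDomain U} {T : V →L[ℝ] V}

/-- The stem condition and `flat_resolvent` make the integrand compatible with conjugation, so the
integral is fixed by `flat` and is a real operator. -/
theorem extend_realPart_rieszDunford (hU : IsOpen U) (hUc : ConjSymmetric U)
    (hT : spectrum ℂ (extend T) ⊆ Δ.carrier) (F : OperatorStem U V) :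
    extend (realPart (rieszDunford Δ T F)) = rieszDunford Δ T F := by
  refine extend_realPart (map_dunford_of_conj hU hUc hT ?_ flatL flat_smul F.2.1 ?_)
  · rw [← complexSpectrum_eq]
    exact conjSymmetric_complexSpectrum T
  · rintro ζ ⟨hζU, hζ⟩
    change flat (_ * _) = _
    rw [map_mul, flat_extendZero hUc F hζU, flat_resolvent hζ]

theorem rieszDunford_add (hT : spectrum ℂ (extend T) ⊆ Δ.carrier) (F G : OperatorStem U V) :
    rieszDunford Δ T (F + G) = rieszDunford Δ T F + rieszDunford Δ T G := by
  simp only [rieszDunford_eq_dunford]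
  rw [← dunford_add hT F.2.1 G.2.1]
  exact dunford_congr _ _ fun ζ hζ => by simp [extendZero_of_mem _ hζ]

theorem rieszDunford_mulScalar (hU : IsOpen U) (hT : spectrum ℂ (extend T) ⊆ Δ.carrier)
    (F : OperatorStem U V) (f : ScalarStem U) :
    rieszDunford Δ T (F.mulScalar f) = rieszDunford Δ T F * rieszDunford Δ T f.toOperator := by
  have h := dunford_smul_eq_mul hU hT F.2.1 f.2.1
  simp only [rieszDunford_eq_dunford]
  convert h using 1
  · exact dunford_congr _ _ fun ζ hζ => by
      simp [extendZero_of_mem _ hζ, OperatorStem.mulScalar]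
  · congr 1
    exact dunford_congr _ _ fun ζ hζ => by
      simp [extendZero_of_mem _ hζ, ScalarStem.toOperator]

theorem rieszDunford_polynomialStem (hU : IsOpen U) (hT : spectrum ℂ (extend T) ⊆ Δ.carrier)
    (m : ℕ) (A : ℕ → V →L[ℝ] V) :
    rieszDunford Δ T (polynomialStem U m A) =
      extend (∑ n ∈ Finset.range (m + 1), A n * T ^ n) := by
  rw [rieszDunford_eq_dunford, dunford_congr (G := fun ζ => ∑ n ∈ Finset.range (m + 1),
    ζ ^ n • extend (A n)) _ _ fun ζ hζ => by rw [extendZero_of_mem _ hζ]; rfl,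
    dunford_sum hT _ fun n _ => by fun_prop]
  simp only [dunford_pow_smul hU hT]
  change _ = extendHom _
  simp only [map_sum, map_mul, map_pow]
  rfl

theorem rieszDunford_one (hT : spectrum ℂ (extend T) ⊆ Δ.carrier) :
    rieszDunford Δ T 1 = 1 := by
  rw [rieszDunford_eq_dunford, ← dunford_one hT]
  exact dunford_congr _ _ fun ζ hζ => by rw [extendZero_of_mem _ hζ]; rfl

end Stem
end

/-- The first conjunct says that the Riesz-Dunford integral can be formed. Together with the
clauses on `Φ` and `φ` (the value of the integral does not depend on the Cauchy domain and lies in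
`B(V)`) it shows that `Φ F = F(T)` and `φ f = f(T)`. -/
theorem theorem3p2 {V : Type*} [NormedAddCommGroup V] [NormedSpace ℝ V] [CompleteSpace V]
    (U : Set ℂ) (hU : IsOpen U) (hUc : ConjSymmetric U)
    (T : V →L[ℝ] V) (hT : complexSpectrum T ⊆ U) :
    (∃ Δ : CauchyDomain U, complexSpectrum T ⊆ Δ.carrier) ∧
    ∃ (Φ : OperatorStem U V →ₗ[ℝ] (V →L[ℝ] V)) (φ : ScalarStem U →ₐ[ℝ] (V →L[ℝ] V)),
      (∀ Δ : CauchyDomain U, complexSpectrum T ⊆ Δ.carrier →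
        ∀ F : OperatorStem U V, rieszDunford Δ T F = Complexified.extend (Φ F)) ∧
      (∀ Δ : CauchyDomain U, complexSpectrum T ⊆ Δ.carrier →
        ∀ f : ScalarStem U, rieszDunford Δ T f.toOperator = Complexified.extend (φ f)) ∧
      (∀ (F : OperatorStem U V) (f : ScalarStem U), Φ (F.mulScalar f) = Φ F * φ f) ∧
      (∀ (m : ℕ) (A : ℕ → V →L[ℝ] V),
        Φ (polynomialStem U m A) = ∑ n ∈ Finset.range (m + 1), A n * T ^ n) := by
  rw [Complexified.complexSpectrum_eq] at hT ⊢
  have hex := CauchyDomain.exists_superset (spectrum.isCompact (Complexified.extend T)) hU hT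
  refine ⟨hex, ?_⟩
  obtain ⟨Δ, hΔ⟩ := hex
  -- One Cauchy domain is fixed to define the calculus; `realPart` loses nothing, since the integral
  -- is a real operator.
  let Φ : OperatorStem U V →ₗ[ℝ] (V →L[ℝ] V) :=
    { toFun := fun F => Complexified.realPart (rieszDunford Δ T F)
      map_add' := fun F G => by rw [rieszDunford_add hΔ, map_add]
      map_smul' := fun r F => by rw [rieszDunford_smul, map_smul, RingHom.id_apply] }
  have hΦ : ∀ F, Complexified.extend (Φ F) = rieszDunford Δ T F :=
    extend_realPart_rieszDunford hU hUc hΔ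
  have hmul : ∀ (F : OperatorStem U V) (f : ScalarStem U),
      Φ (F.mulScalar f) = Φ F * Φ f.toOperator := fun F f => by
    refine Complexified.extend_injective ?_
    rw [hΦ, rieszDunford_mulScalar hU hΔ, ← hΦ, ← hΦ]
    rfl
  have halg : ∀ r : ℝ, Φ (algebraMap ℝ (ScalarStem U) r).toOperator = algebraMap ℝ _ r := by
    intro r
    have h1 : Φ 1 = 1 := Complexified.extend_injective (by rw [hΦ, rieszDunford_one hΔ]; rfl)
    rw [ScalarStem.toOperator_algebraMap, Algebra.algebraMap_eq_smul_one, map_smul, h1,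
      Algebra.algebraMap_eq_smul_one]
  -- Multiplicativity is `hmul` applied to the operator-valued function ζ ↦ f(ζ) · 1.
  let φ : ScalarStem U →ₐ[ℝ] (V →L[ℝ] V) :=
    { toFun := fun f => Φ f.toOperator
      map_one' := by simpa using halg 1
      map_mul' := fun f g => by rw [ScalarStem.toOperator_mul, hmul]
      map_zero' := by simpa using halg 0
      map_add' := fun f g => by rw [ScalarStem.toOperator_add, map_add]
      commutes' := halg }
  have hind : ∀ Δ' : CauchyDomain U, spectrum ℂ (Complexified.extend T) ⊆ Δ'.carrier →
      ∀ F : OperatorStem U V, rieszDunford Δ' T F = Complexified.extend (Φ F) := fun Δ' hΔ' F => by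
    rw [hΦ]
    exact dunford_eq_dunford hU hΔ' hΔ F.2.1
  refine ⟨Φ, φ, hind, fun Δ' hΔ' f => hind Δ' hΔ' f.toOperator, hmul, fun m A => ?_⟩
  refine Complexified.extend_injective ?_
  rw [hΦ, rieszDunford_polynomialStem hU hΔ]
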